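/- Let $(M^3,g)$ be an oriented smooth Riemannian $3$-manifold with Levi-Civita connection $\nabla$ and Riemannian volume form $\det_g$, let $\mathcal U\subset\mathbf R^2$ be open with coordinates $(u,v)$, and let $f:\mathcal U\to M^3$ be a front with unit normal $\nu$: that is, $f$ is smooth, $\nu$ is a smooth unit vector field along $f$ perpendicular to the image of $df$ at every point, and $\nu:\mathcal U\to TM^3$ is an immersion. Let $p\in\mathcal U$ be a rank one singular point of $f$, i.e. $\dim\ker df(p)=1$. An admissible coordinate system at $p$ is an orientation-preserving smooth local coordinate system $(x,y)$ of $\mathcal U$ centered at $p$ with $f_y(p)=0$; the number $$\kappa_\nu(p)=\frac{\langle\nabla_{\partial_x}f_x,\nu\rangle}{|f_x|^2}\Big|_p$$ does not depend on its choice and is called the limiting normal curvature. Let $d\hat A=\lambda\,du\wedge dv$, $\lambda=\det_g(f_u,f_v,\nu)$, be the signed area element, and let $K$ be the Gaussian curvature of $f$, i.e. the curvature of the metric induced by $f$ on the set of regular points. The $2$-form $K\,d\hat A$, defined at regular points, extends to a smooth $2$-form on $\mathcal U$, whose value at a singular point is $\det_g(\nabla_u\nu,\nabla_v\nu,\nu)\,du\wedge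 dv$; the extension is again denoted by $K\,d\hat A$. Then the following two conditions are equivalent: (1) $\kappa_\nu(p)=0$; (2) the $2$-form $K\,d\hat A$ vanishes at $p$. Moreover, if $(M^3,g)$ is Euclidean $3$-space $\mathbf R^3$, then (1) and (2) are also equivalent to (3) the Gauss map $\nu:\mathcal U\to S^2\subset\mathbf R^3$ is not an immersion at $p$. -/

import Mathlib

open Bundle
open scoped Manifold ContDiff Topology Bundle RealInnerProductSpace

/-- The model space of 3-manifolds (with its Euclidean structure, it is Euclidean 3-space). -/
abbrev E3 : Type := EuclideanSpace ℝ (Fin 3)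

instance factFinrankTangentSpaceE3 {M : Type*} [TopologicalSpace M] [ChartedSpace E3 M] (x : M) :
    Fact (Module.finrank ℝ (TangentSpace 𝓘(ℝ, E3) x) = 3) :=
  ⟨(finrank_euclideanSpace_fin : Module.finrank ℝ E3 = 3)⟩

instance finiteDimensionalTangentSpaceE3 {M : Type*} [TopologicalSpace M] [ChartedSpace E3 M]
    (x : M) : FiniteDimensional ℝ (TangentSpace 𝓘(ℝ, E3) x) :=
  inferInstanceAs (FiniteDimensional ℝ E3)

noncomputable section

namespace Front

/-- The Christoffel symbols of the first kind at `y` of a metric `G` on a vector space: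
`c ↦ (∂_a g_{bc} + ∂_b g_{ac} - ∂_c g_{ab}) / 2`. -/
def christoffelFst {E : Type*} [NormedAddCommGroup E] [NormedSpace ℝ E]
    (G : E → E →L[ℝ] E →L[ℝ] ℝ) (y a b : E) : E →L[ℝ] ℝ :=
  (1 / 2 : ℝ) • (fderiv ℝ G y a b + fderiv ℝ G y b a - ((fderiv ℝ G y).flip a).flip b)

section Ambient

/-! ### The ambient Riemannian 3-manifold -/

variable {M : Type*} [TopologicalSpace M] [ChartedSpace E3 M] [IsManifold 𝓘(ℝ, E3) ∞ M]
  [RiemannianBundle (fun x : M ↦ TangentSpace 𝓘(ℝ, E3) x)]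

/-- A family of orientations of the tangent spaces is an orientation of `M` when it is locally
constant, i.e. when its Riemannian volume form, read in the chart at `x`, is continuous at `x`
(the trivialization of the tangent bundle at `x` is the derivative of the chart at `x`). -/
def IsManifoldOrientation (o : ∀ x : M, Orientation ℝ (TangentSpace 𝓘(ℝ, E3) x) (Fin 3)) : Prop :=
  ∀ (x : M) (a : Fin 3 → E3), ContinuousAt (fun y : M ↦ (o y).volumeForm
    (fun i ↦ (trivializationAt E3 (TangentSpace 𝓘(ℝ, E3)) x).symm y (a i))) x

/-- The metric read in the chart at `x`, as a function of the point `y` of the model space: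
`(a, b) ↦ g_{ab}(y)`. -/
def chartMetric (x : M) (y : E3) : E3 →L[ℝ] E3 →L[ℝ] ℝ :=
  let z : M := (extChartAt 𝓘(ℝ, E3) x).symm y
  let s : E3 →L[ℝ] TangentSpace 𝓘(ℝ, E3) z :=
    (trivializationAt E3 (TangentSpace 𝓘(ℝ, E3)) x).symmL ℝ z
  (innerSL ℝ : TangentSpace 𝓘(ℝ, E3) z →L[ℝ] TangentSpace 𝓘(ℝ, E3) z →L[ℝ] ℝ).bilinearComp s s

/-- The Christoffel symbols `Γ(a, b)` of the Levi-Civita connection at `x`, in the chart at `x`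
(Mathlib identifies the tangent space at `x` with the model space through the chart at `x`). -/
def christoffel (x : M) (a b : TangentSpace 𝓘(ℝ, E3) x) : TangentSpace 𝓘(ℝ, E3) x :=
  let k : E3 →L[ℝ] ℝ :=
    christoffelFst (E := E3) (chartMetric x) (extChartAt 𝓘(ℝ, E3) x x) a b
  (InnerProductSpace.toDual ℝ (TangentSpace 𝓘(ℝ, E3) x)).symm k

/-- The directional derivative `df(w)` at `q` of a map `f` from the plane to `M`. -/
def vel (f : ℝ × ℝ → M) (w : ℝ × ℝ) (q : ℝ × ℝ) : TangentSpace 𝓘(ℝ, E3) (f q) :=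
  mfderiv 𝓘(ℝ, ℝ × ℝ) 𝓘(ℝ, E3) f q w

/-- The Levi-Civita covariant derivative `∇_w V` at `q` of a vector field `V` along `f`:
`(∇_w V)^k = ∂_w V^k + Γ^k_{ij} (∂_w f^i) V^j` in the chart of `M` at `f q`. -/
def covDeriv (f : ℝ × ℝ → M) (V : ∀ q, TangentSpace 𝓘(ℝ, E3) (f q)) (w : ℝ × ℝ) (q : ℝ × ℝ) :
    TangentSpace 𝓘(ℝ, E3) (f q) :=
  let Vcoord : ℝ × ℝ → E3 := fun q' ↦
    (trivializationAt E3 (TangentSpace 𝓘(ℝ, E3)) (f q) ⟨f q', V q'⟩).2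
  let ordinary : TangentSpace 𝓘(ℝ, E3) (f q) := fderiv ℝ Vcoord q w
  ordinary + christoffel (f q) (vel f w q) (V q)

/-! ### Fronts -/

/-- `f` is a frontal on `U` with unit normal vector field `ν`. -/
structure IsFrontal (f : ℝ × ℝ → M) (ν : ∀ q, TangentSpace 𝓘(ℝ, E3) (f q)) (U : Set (ℝ × ℝ)) :
    Prop where
  smooth : ContMDiffOn 𝓘(ℝ, ℝ × ℝ) 𝓘(ℝ, E3) ∞ f U
  smooth_normal : ContMDiffOn 𝓘(ℝ, ℝ × ℝ) 𝓘(ℝ, E3).tangent ∞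
    (fun q ↦ (⟨f q, ν q⟩ : TangentBundle 𝓘(ℝ, E3) M)) U
  unit : ∀ q ∈ U, ‖ν q‖ = 1
  normal : ∀ q ∈ U, ∀ w : ℝ × ℝ, ⟪vel f w q, ν q⟫ = 0

/-- `f` is a front on `U` with unit normal vector field `ν`: in addition, `ν : U → TM` is an
immersion. -/
structure IsFront (f : ℝ × ℝ → M) (ν : ∀ q, TangentSpace 𝓘(ℝ, E3) (f q)) (U : Set (ℝ × ℝ)) :
    Prop extends IsFrontal f ν U where
  immersion : ∀ q ∈ U, Function.Injective (mfderiv 𝓘(ℝ, ℝ × ℝ) 𝓘(ℝ, E3).tangent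
    (fun q' ↦ (⟨f q', ν q'⟩ : TangentBundle 𝓘(ℝ, E3) M)) q)

/-- `p` is a singular point of `f`: `f` is not an immersion at `p`. -/
def IsSingularPoint (f : ℝ × ℝ → M) (p : ℝ × ℝ) : Prop :=
  ¬ Function.Injective (mfderiv 𝓘(ℝ, ℝ × ℝ) 𝓘(ℝ, E3) f p)

/-- `p` is a rank one singular point of `f`: the kernel of `df(p)` is one-dimensional. -/
def IsRankOneSingularPoint (f : ℝ × ℝ → M) (p : ℝ × ℝ) : Prop :=
  Module.finrank ℝ (mfderiv 𝓘(ℝ, ℝ × ℝ) 𝓘(ℝ, E3) f p).ker = 1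

/-! ### The limiting normal curvature -/

/-- `φ` is (the inverse of) an admissible local coordinate system of `U` centered at `p`:
a smooth, orientation preserving local parametrization with `φ 0 = p`
such that `∂_v (f ∘ φ)` vanishes at the origin. -/
structure IsAdmissible (f : ℝ × ℝ → M) (U : Set (ℝ × ℝ)) (p : ℝ × ℝ)
    (φ : OpenPartialHomeomorph (ℝ × ℝ) (ℝ × ℝ)) : Prop where
  zero_mem : (0 : ℝ × ℝ) ∈ φ.source
  map_zero : φ 0 = p
  target_subset : φ.target ⊆ U
  smooth : ContDiffOn ℝ ∞ φ φ.source
  smooth_symm : ContDiffOn ℝ ∞ φ.symm φ.target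
  orientation : ∀ z ∈ φ.source, 0 < (fderiv ℝ φ z).det
  null : vel (fun z ↦ f (φ z)) (0, 1) 0 = 0

/-- `⟨f_uu, ν⟩ / |f_u|²` at the origin of the coordinate system `φ`, where `f_uu = ∇_{∂_u} f_u`. -/
def normalCurvatureIn (f : ℝ × ℝ → M) (ν : ∀ q, TangentSpace 𝓘(ℝ, E3) (f q))
    (φ : OpenPartialHomeomorph (ℝ × ℝ) (ℝ × ℝ)) : ℝ :=
  ⟪covDeriv (fun z ↦ f (φ z)) (vel (fun z ↦ f (φ z)) (1, 0)) (1, 0) 0, ν (φ 0)⟫ /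
    ‖vel (fun z ↦ f (φ z)) (1, 0) 0‖ ^ 2

/-- `κ` is the limiting normal curvature of `f` at `p`: the value of `⟨f_uu, ν⟩ / |f_u|²` at `p` in
an admissible coordinate system, whichever such system is used. -/
def IsLimitingNormalCurvature (f : ℝ × ℝ → M) (ν : ∀ q, TangentSpace 𝓘(ℝ, E3) (f q))
    (U : Set (ℝ × ℝ)) (p : ℝ × ℝ) (κ : ℝ) : Prop :=
  (∃ φ, IsAdmissible f U p φ) ∧ ∀ φ, IsAdmissible f U p φ → normalCurvatureIn f ν φ = κ

/-! ### Gaussian curvature and signed area element -/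

/-- The derivative of a function of `(u, v)` in the direction `w`. -/
def pd (w : ℝ × ℝ) (h : ℝ × ℝ → ℝ) : ℝ × ℝ → ℝ := fun q ↦ fderiv ℝ h q w

/-- The coefficient `⟨df(w), df(w')⟩` of the first fundamental form. -/
def fstForm (f : ℝ × ℝ → M) (w w' : ℝ × ℝ) : ℝ × ℝ → ℝ := fun q ↦ ⟪vel f w q, vel f w' q⟫

/-- The Gaussian curvature `K` of `f` at a regular point, i.e. the curvature of the induced metric
`E du² + 2 F du dv + G dv²`, by Brioschi's formula. -/
def gaussCurvature (f : ℝ × ℝ → M) (q : ℝ × ℝ) : ℝ :=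
  let du : ℝ × ℝ := (1, 0)
  let dv : ℝ × ℝ := (0, 1)
  let E := fstForm f du du
  let F := fstForm f du dv
  let G := fstForm f dv dv
  (Matrix.det !![-(1 / 2) * pd dv (pd dv E) q + pd du (pd dv F) q - (1 / 2) * pd du (pd du G) q,
        (1 / 2) * pd du E q, pd du F q - (1 / 2) * pd dv E q;
      pd dv F q - (1 / 2) * pd du G q, E q, F q;
      (1 / 2) * pd dv G q, F q, G q]
    - Matrix.det !![0, (1 / 2) * pd dv E q, (1 / 2) * pd du G q;
      (1 / 2) * pd dv E q, E q, F q;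
      (1 / 2) * pd du G q, F q, G q]) / (E q * G q - F q ^ 2) ^ 2

/-- The coefficient `λ = det_g(f_u, f_v, ν)` of the signed area element `dÂ = λ du ∧ dv`, where
`det_g` is the Riemannian volume form of `M`. -/
def signedArea (o : ∀ x : M, Orientation ℝ (TangentSpace 𝓘(ℝ, E3) x) (Fin 3))
    (f : ℝ × ℝ → M) (ν : ∀ q, TangentSpace 𝓘(ℝ, E3) (f q)) (q : ℝ × ℝ) : ℝ :=
  (o (f q)).volumeForm ![vel f (1, 0) q, vel f (0, 1) q, ν q]

open Classical in
/-- The coefficient of `du ∧ dv` in the 2-form `K dÂ`, extended across the singular set.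
At a regular point it is `K λ`. At a singular point `K` is not defined, and the extended form takes
the value `det_g(∇_u ν, ∇_v ν, ν)`: writing `K = K_ext + c_g(ν^⊥)`, one has
`K_ext dÂ = det_g(∇_u ν, ∇_v ν, ν) du ∧ dv`, while `c_g(ν^⊥) dÂ` vanishes with `λ`. That this
extension is smooth is not part of the definition. -/
def KdA (o : ∀ x : M, Orientation ℝ (TangentSpace 𝓘(ℝ, E3) x) (Fin 3))
    (f : ℝ × ℝ → M) (ν : ∀ q, TangentSpace 𝓘(ℝ, E3) (f q)) (q : ℝ × ℝ) : ℝ :=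
  if IsSingularPoint f q then
    (o (f q)).volumeForm ![covDeriv f ν (1, 0) q, covDeriv f ν (0, 1) q, ν q]
  else gaussCurvature f q * signedArea o f ν q

end Ambient

end Front

end

noncomputable section

set_option maxSynthPendingDepth 3

/-! Let `S w = ∇_w ν`. It takes values in the plane orthogonal to `ν`, and `⟪df a, S b⟫` is
symmetric in `a` and `b`, because it is minus the second fundamental form and the connection is
torsion-free. Both conditions say that `S` is not injective at `p`.

For (2): at a singular point the coefficient of `K dÂ` is `det_g(S ∂u, S ∂v, ν)`, whose square is
the Gram determinant of `S` (`IsFrontal.KdA_eq_zero_iff`). For (1): take `b` spanning `ker df(p)`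
and `a` independent of `b`. Then `κ_ν = -⟪df a, S a⟫ / |df a|²`. Symmetry gives `⟪df a, S b⟫ = ⟪df
b, S a⟫ = 0`, and the front condition gives `S b ≠ 0` (`IsFront.covDeriv_ne_zero`), so `df a`, `S
b`, `ν` is an orthogonal frame. Hence `⟪df a, S a⟫ = 0` exactly when `S a` is parallel to `S b`
(`IsFront.inner_vel_covDeriv_eq_zero_iff`). In Euclidean space `S = dν`, which gives (3).

Most of the work goes into the smooth extension. Brioschi's formula and the Gauss equation give `K λ
= det_g(∇_u ν, ∇_v ν, ν) + ρ / λ`, where `ρ` is the ambient curvature evaluated on `f_u, f_v`. Such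
a biquadratic form scales with the square of the area, so `ρ = λ² c`, where `c` is the sectional
curvature of the plane `ν^⊥`; that plane varies smoothly even across singular points. Thus `K dÂ`
has the coefficient `det_g(∇_u ν, ∇_v ν, ν) + λ c` everywhere, with no division by `λ`
(`IsFrontal.KdA_eq`). -/

namespace Front

/-! ### Volume forms in dimension three and the algebra of the Gauss equation -/

section LinearAlgebra

variable {V : Type*} [NormedAddCommGroup V] [InnerProductSpace ℝ V] [Fact (Module.finrank ℝ V = 3)]

/-- The Gram identity for the volume form of an oriented 3-dimensional Euclidean space. -/
theorem volumeForm_mul_volumeForm (o : Orientation ℝ V (Fin 3)) (x y : Fin 3 → V) :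
    o.volumeForm x * o.volumeForm y = Matrix.det (Matrix.of fun i j ↦ ⟪x i, y j⟫) := by
  let b := o.finOrthonormalBasis (by norm_num) Fact.out
  have hb : b.toBasis.orientation = o := o.finOrthonormalBasis_orientation _ _
  rw [o.volumeForm_robust b hb, Module.Basis.det_apply, Module.Basis.det_apply,
    ← Matrix.det_transpose (b.toBasis.toMatrix x), ← Matrix.det_mul]
  congr 1
  ext i j
  simp only [Matrix.mul_apply, Matrix.transpose_apply, Module.Basis.toMatrix_apply,
    OrthonormalBasis.coe_toBasis_repr_apply, Matrix.of_apply, OrthonormalBasis.repr_apply_apply]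
  rw [← b.sum_inner_mul_inner (x i) (y j)]
  simp [real_inner_comm]

theorem volumeForm_mul_volumeForm_fin_three (o : Orientation ℝ V (Fin 3)) (a b c x y z : V) :
    o.volumeForm ![a, b, c] * o.volumeForm ![x, y, z] =
      ⟪a, x⟫ * (⟪b, y⟫ * ⟪c, z⟫ - ⟪b, z⟫ * ⟪c, y⟫) - ⟪a, y⟫ * (⟪b, x⟫ * ⟪c, z⟫ - ⟪b, z⟫ * ⟪c, x⟫)
        + ⟪a, z⟫ * (⟪b, x⟫ * ⟪c, y⟫ - ⟪b, y⟫ * ⟪c, x⟫) := by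
  rw [volumeForm_mul_volumeForm, Matrix.det_fin_three]
  simp
  ring

/-- The square of the area density is `EG - F²`. -/
theorem volumeForm_sq_of_normal (o : Orientation ℝ V (Fin 3)) {a b n : V} (hn : ⟪n, n⟫ = 1)
    (ha : ⟪a, n⟫ = 0) (hb : ⟪b, n⟫ = 0) :
    o.volumeForm ![a, b, n] ^ 2 = ⟪a, a⟫ * ⟪b, b⟫ - ⟪a, b⟫ ^ 2 := by
  rw [sq, volumeForm_mul_volumeForm_fin_three, hn, ha, hb, real_inner_comm a b]
  ring

/-- Only the normal component of `x` contributes, since its tangential part lies in the span of `a`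
and `b`. The Gram identity yields this after multiplication by the nonzero volume. -/
theorem volumeForm_eq_mul_inner_normal (o : Orientation ℝ V (Fin 3)) {a b n : V}
    (hn : ⟪n, n⟫ = 1) (ha : ⟪a, n⟫ = 0) (hb : ⟪b, n⟫ = 0)
    (h0 : o.volumeForm ![a, b, n] ≠ 0) (x : V) :
    o.volumeForm ![x, a, b] = o.volumeForm ![a, b, n] * ⟪x, n⟫ := by
  have h := volumeForm_mul_volumeForm_fin_three o x a b a b n
  have h2 := volumeForm_sq_of_normal o hn ha hb
  apply mul_right_cancel₀ h0
  rw [h, ha, hb, real_inner_comm a b]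
  linear_combination (-⟪x, n⟫) * h2

/-- The determinant of Brioschi's formula in terms of the shape operator: the algebraic part of
Gauss' equation. Here `a, b, c` stand for the second covariant derivatives of an immersion with
derivatives `p, q`, the vectors `x, y` for the covariant derivatives of the unit normal `n`. -/
theorem brioschi_div_mul_volumeForm (o : Orientation ℝ V (Fin 3)) {p q n a b c x y : V} {ρ : ℝ}
    (hn : ⟪n, n⟫ = 1) (hp : ⟪p, n⟫ = 0) (hq : ⟪q, n⟫ = 0) (h0 : o.volumeForm ![p, q, n] ≠ 0)
    (hx : ⟪x, n⟫ = 0) (hy : ⟪y, n⟫ = 0)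
    (hpx : ⟪a, n⟫ = -⟪p, x⟫) (hpy : ⟪b, n⟫ = -⟪p, y⟫) (hqx : ⟪b, n⟫ = -⟪q, x⟫)
    (hqy : ⟪c, n⟫ = -⟪q, y⟫) :
    (Matrix.det !![⟪a, c⟫ - ⟪b, b⟫ + ρ, ⟪a, p⟫, ⟪a, q⟫; ⟪c, p⟫, ⟪p, p⟫, ⟪p, q⟫;
        ⟪c, q⟫, ⟪p, q⟫, ⟪q, q⟫] -
      Matrix.det !![0, ⟪b, p⟫, ⟪b, q⟫; ⟪b, p⟫, ⟪p, p⟫, ⟪p, q⟫; ⟪b, q⟫, ⟪p, q⟫, ⟪q, q⟫]) /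
      (⟪p, p⟫ * ⟪q, q⟫ - ⟪p, q⟫ ^ 2) ^ 2 * o.volumeForm ![p, q, n] =
    o.volumeForm ![x, y, n] + ρ / o.volumeForm ![p, q, n] := by
  have hvol := volumeForm_eq_mul_inner_normal o hn hp hq h0
  have h2 := volumeForm_sq_of_normal o hn hp hq
  -- Moving `⟪b, b⟫` from the first corner entry to the second turns the difference of Brioschi's
  -- determinants into two Gram determinants plus `ρ (EG - F²)`. Each Gram determinant is a product
  -- of volumes, so only normal components survive.
  have hac := volumeForm_mul_volumeForm_fin_three o a p q c p q
  have hbb := volumeForm_mul_volumeForm_fin_three o b p q b p q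
  have hxy := volumeForm_mul_volumeForm_fin_three o p q n x y n
  have c1 : ⟪n, x⟫ = 0 := by rw [real_inner_comm, hx]
  have c2 : ⟪n, y⟫ = 0 := by rw [real_inner_comm, hy]
  rw [hvol, hvol, real_inner_comm c p, real_inner_comm c q, real_inner_comm p q] at hac
  rw [hvol, real_inner_comm b p, real_inner_comm b q, real_inner_comm p q] at hbb
  rw [hn, c1, c2, hp, hq] at hxy
  set l := o.volumeForm ![p, q, n]
  rw [← h2, Matrix.det_fin_three, Matrix.det_fin_three]
  have key : ⟪a, n⟫ * ⟪c, n⟫ - ⟪b, n⟫ * ⟪b, n⟫ = l * o.volumeForm ![x, y, n] := by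
    rw [hxy]
    -- The two factors `⟪b, n⟫` are rewritten differently, as `-⟪p, y⟫` and `-⟪q, x⟫`, to match the
    -- mixed products of the Gram determinant.
    nth_rewrite 1 [hpy]
    rw [hpx, hqy, hqx]
    ring
  simp only [Matrix.of_apply, Matrix.cons_val', Matrix.cons_val_zero, Matrix.cons_val_one,
    Matrix.cons_val]
  field_simp
  linear_combination ρ * (-h2) - hac + hbb + l ^ 2 * key

end LinearAlgebra

/-! ### Biquadratic forms of curvature type -/

section CurvatureTensor

variable {E : Type*} [AddCommGroup E] [Module ℝ E]

/-- The biquadratic form `R(a, b, a, b)` attached to a quadrilinear form `B` which is symmetric in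
its first two and in its last two arguments. -/
def sectional (B : E → E → E → E → ℝ) (a b : E) : ℝ :=
  B a b a b - (1 / 2) * B b b a a - (1 / 2) * B a a b b

/-- The combination `sectional B` is in effect a quadratic form on bivectors, so a change of basis
acts through the square of its determinant. This is what makes curvature divided by squared area
depend only on the plane. -/
theorem sectional_combination {B : E → E → E → E → ℝ}
    (h₁ : ∀ a b c d, B a b c d = B b a c d) (h₂ : ∀ a b c d, B a b c d = B a b d c)
    (add₁ : ∀ a a' b c d, B (a + a') b c d = B a b c d + B a' b c d)
    (smul₁ : ∀ (r : ℝ) a b c d, B (r • a) b c d = r * B a b c d)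
    (add₃ : ∀ a b c c' d, B a b (c + c') d = B a b c d + B a b c' d)
    (smul₃ : ∀ (r : ℝ) a b c d, B a b (r • c) d = r * B a b c d)
    (x y : E) (α β γ δ : ℝ) :
    sectional B (α • x + β • y) (γ • x + δ • y) = (α * δ - β * γ) ^ 2 * sectional B x y := by
  have add₂ : ∀ a b b' c d, B a (b + b') c d = B a b c d + B a b' c d := fun a b b' c d ↦ by
    rw [h₁, add₁, h₁ b, h₁ b']
  have smul₂ : ∀ (r : ℝ) a b c d, B a (r • b) c d = r * B a b c d := fun r a b c d ↦ by
    rw [h₁, smul₁, h₁ b]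
  have add₄ : ∀ a b c d d', B a b c (d + d') = B a b c d + B a b c d' := fun a b c d d' ↦ by
    rw [h₂, add₃, h₂ _ _ d, h₂ _ _ d']
  have smul₄ : ∀ (r : ℝ) a b c d, B a b c (r • d) = r * B a b c d := fun r a b c d ↦ by
    rw [h₂, smul₃, h₂ _ _ d]
  simp only [sectional, add₁, add₂, add₃, add₄, smul₁, smul₂, smul₃, smul₄]
  simp only [h₁ y x, h₂ _ _ y x]
  ring

theorem sectional_smul_smul {B : E → E → E → E → ℝ}
    (h₁ : ∀ a b c d, B a b c d = B b a c d) (h₂ : ∀ a b c d, B a b c d = B a b d c)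
    (smul₁ : ∀ (r : ℝ) a b c d, B (r • a) b c d = r * B a b c d)
    (smul₃ : ∀ (r : ℝ) a b c d, B a b (r • c) d = r * B a b c d) (r : ℝ) (a b : E) :
    sectional B (r • a) (r • b) = r ^ 4 * sectional B a b := by
  have smul₂ : ∀ (r : ℝ) a b c d, B a (r • b) c d = r * B a b c d := fun r a b c d ↦ by
    rw [h₁, smul₁, h₁ b]
  have smul₄ : ∀ (r : ℝ) a b c d, B a b c (r • d) = r * B a b c d := fun r a b c d ↦ by
    rw [h₂, smul₃, h₂ _ _ d]
  simp only [sectional, smul₁, smul₂, smul₃, smul₄]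
  ring

end CurvatureTensor

/-! ### Coordinate calculus of a metric: covariant derivatives and the Gauss equation -/

section MetricGeometry

set_option maxHeartbeats 1000000

section Calculus

variable {P E E' : Type*} [NormedAddCommGroup P] [NormedSpace ℝ P] [NormedAddCommGroup E]
  [NormedSpace ℝ E] [NormedAddCommGroup E'] [NormedSpace ℝ E']

theorem christoffelFst_apply (G : E → E →L[ℝ] E →L[ℝ] ℝ) (y a b c : E) :
    christoffelFst G y a b c =
      (1 / 2) * (fderiv ℝ G y a b c + fderiv ℝ G y b a c - fderiv ℝ G y c a b) := by
  simp [christoffelFst]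

/-- The derivative of a field of symmetric bilinear forms is symmetric. -/
theorem fderiv_bilin_symm {G : E → E →L[ℝ] E →L[ℝ] ℝ} {y : E} (hG : DifferentiableAt ℝ G y)
    (hs : ∀ᶠ z in 𝓝 y, ∀ a b, G z a b = G z b a) (w a b : E) :
    fderiv ℝ G y w a b = fderiv ℝ G y w b a := by
  have key : ∀ a b, fderiv ℝ (fun z ↦ G z a b) y w = fderiv ℝ G y w a b := fun a b ↦ by
    rw [fderiv_clm_apply (by fun_prop) (by fun_prop), fderiv_clm_apply (by fun_prop) (by fun_prop)]
    simp
  rw [← key, ← key]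
  congr 1
  exact Filter.EventuallyEq.fderiv_eq (hs.mono fun z h ↦ h a b)

theorem christoffelFst_symm {G : E → E →L[ℝ] E →L[ℝ] ℝ} {y : E} (hG : DifferentiableAt ℝ G y)
    (hs : ∀ᶠ z in 𝓝 y, ∀ a b, G z a b = G z b a) (a b : E) :
    christoffelFst G y a b = christoffelFst G y b a := by
  ext c
  rw [christoffelFst_apply, christoffelFst_apply, fderiv_bilin_symm hG hs c a b]
  ring

theorem fderiv_bilin_apply {c : P → E →L[ℝ] E →L[ℝ] ℝ} {A B : P → E} {q : P}
    (hc : DifferentiableAt ℝ c q) (hA : DifferentiableAt ℝ A q) (hB : DifferentiableAt ℝ B q)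
    (w : P) : fderiv ℝ (fun x ↦ c x (A x) (B x)) q w =
      fderiv ℝ c q w (A q) (B q) + c q (fderiv ℝ A q w) (B q) + c q (A q) (fderiv ℝ B q w) := by
  rw [fderiv_clm_apply (by fun_prop) hB, fderiv_clm_apply hc hA]
  simp
  ring

theorem fderiv_comp_apply {G : E → E'} {F : P → E} {q : P} (hG : DifferentiableAt ℝ G (F q))
    (hF : DifferentiableAt ℝ F q) (w : P) :
    fderiv ℝ (fun x ↦ G (F x)) q w = fderiv ℝ G (F q) (fderiv ℝ F q w) := by
  have := fderiv_comp q hG hF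
  rw [Function.comp_def] at this
  rw [this]; rfl

/-- The covariant derivative in the direction `w` of a vector field `A` along `F`, as a covector. -/
def lowerCov (G : E → E →L[ℝ] E →L[ℝ] ℝ) (F A : P → E) (w q : P) : E →L[ℝ] ℝ :=
  G (F q) (fderiv ℝ A q w) + christoffelFst G (F q) (fderiv ℝ F q w) (A q)

theorem lowerCov_apply (G : E → E →L[ℝ] E →L[ℝ] ℝ) (F A : P → E) (w q : P) (c : E) :
    lowerCov G F A w q c =
      G (F q) (fderiv ℝ A q w) c + christoffelFst G (F q) (fderiv ℝ F q w) (A q) c := rfl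

/-- The Levi-Civita connection is compatible with the metric. -/
theorem fderiv_metric {G : E → E →L[ℝ] E →L[ℝ] ℝ} {F A B : P → E} {q : P}
    (hG : DifferentiableAt ℝ G (F q)) (hs : ∀ᶠ z in 𝓝 (F q), ∀ a b, G z a b = G z b a)
    (hF : DifferentiableAt ℝ F q) (hA : DifferentiableAt ℝ A q) (hB : DifferentiableAt ℝ B q)
    (w : P) : fderiv ℝ (fun x ↦ G (F x) (A x) (B x)) q w =
      lowerCov G F A w q (B q) + lowerCov G F B w q (A q) := by
  have hGF : DifferentiableAt ℝ (fun x ↦ G (F x)) q := hG.comp q hF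
  rw [fderiv_bilin_apply hGF hA hB, fderiv_comp_apply hG hF, lowerCov_apply, lowerCov_apply,
    christoffelFst_apply, christoffelFst_apply, hs.self_of_nhds _ (A q),
    fderiv_bilin_symm hG hs _ (A q) (B q), fderiv_bilin_symm hG hs _ (fderiv ℝ F q w) (B q),
    fderiv_bilin_symm hG hs _ (fderiv ℝ F q w) (A q), fderiv_bilin_symm hG hs _ (B q) (A q)]
  ring

theorem fderiv_fderiv_apply {F : P → E} {q : P} (hF : ContDiffAt ℝ 2 F q) (a b : P) :
    fderiv ℝ (fun x ↦ fderiv ℝ F x a) q b = fderiv ℝ (fderiv ℝ F) q b a := by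
  have h : DifferentiableAt ℝ (fderiv ℝ F) q :=
    (hF.fderiv_right (m := 1) (by norm_num)).differentiableAt (by norm_num)
  rw [fderiv_clm_apply h (by fun_prop)]
  simp

theorem fderiv_fderiv_comm {F : P → E} {q : P} (hF : ContDiffAt ℝ 2 F q) (a b : P) :
    fderiv ℝ (fun x ↦ fderiv ℝ F x a) q b = fderiv ℝ (fun x ↦ fderiv ℝ F x b) q a := by
  rw [fderiv_fderiv_apply hF, fderiv_fderiv_apply hF]
  exact (hF.isSymmSndFDerivAt (by simp)).eq b a

/-- Covariant derivatives do not depend on the coordinate system: `τ` is the change of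
coordinates. -/
theorem lowerCov_change {G₀ : E → E →L[ℝ] E →L[ℝ] ℝ} {G₁ : E' → E' →L[ℝ] E' →L[ℝ] ℝ} {τ : E → E'}
    {F A : P → E} {F₁ A₁ : P → E'} {q : P} (hτ : ContDiffAt ℝ 2 τ (F q))
    (hG₁ : DifferentiableAt ℝ G₁ (τ (F q))) (hs : ∀ᶠ z in 𝓝 (τ (F q)), ∀ a b, G₁ z a b = G₁ z b a)
    (hG : ∀ᶠ y in 𝓝 (F q), ∀ a b, G₀ y a b = G₁ (τ y) (fderiv ℝ τ y a) (fderiv ℝ τ y b))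
    (hG₀ : DifferentiableAt ℝ G₀ (F q))
    (hF : DifferentiableAt ℝ F q) (hA : DifferentiableAt ℝ A q)
    (hF₁ : F₁ =ᶠ[𝓝 q] fun x ↦ τ (F x)) (hA₁ : A₁ =ᶠ[𝓝 q] fun x ↦ fderiv ℝ τ (F x) (A x))
    (w : P) (c : E) :
    lowerCov G₀ F A w q c = lowerCov G₁ F₁ A₁ w q (fderiv ℝ τ (F q) c) := by
  have hτ1 : DifferentiableAt ℝ τ (F q) := hτ.differentiableAt (by norm_num)
  have hτ' : DifferentiableAt ℝ (fderiv ℝ τ) (F q) :=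
    (hτ.fderiv_right (m := 1) (by norm_num)).differentiableAt (by norm_num)
  have hτ'' : ∀ a b, fderiv ℝ (fderiv ℝ τ) (F q) a b = fderiv ℝ (fderiv ℝ τ) (F q) b a :=
    fun a b ↦ (hτ.isSymmSndFDerivAt (by simp)).eq a b
  -- The derivative of `G₀ = τ^* G₁`. In the Christoffel combination the terms with `τ''` collapse
  -- to a single one, which is the inhomogeneous term in the derivative of `A₁`.
  have hd : ∀ w a b, fderiv ℝ G₀ (F q) w a b =
      fderiv ℝ G₁ (τ (F q)) (fderiv ℝ τ (F q) w) (fderiv ℝ τ (F q) a) (fderiv ℝ τ (F q) b) +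
      G₁ (τ (F q)) (fderiv ℝ (fderiv ℝ τ) (F q) w a) (fderiv ℝ τ (F q) b) +
      G₁ (τ (F q)) (fderiv ℝ τ (F q) a) (fderiv ℝ (fderiv ℝ τ) (F q) w b) := by
    intro w a b
    have h1 : fderiv ℝ G₀ (F q) w a b = fderiv ℝ (fun y ↦ G₀ y a b) (F q) w := by
      rw [fderiv_bilin_apply hG₀ (by fun_prop) (by fun_prop)]
      simp
    have h2 : (fun y ↦ G₀ y a b) =ᶠ[𝓝 (F q)]
        fun y ↦ G₁ (τ y) (fderiv ℝ τ y a) (fderiv ℝ τ y b) := hG.mono fun y h ↦ h a b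
    have hc : DifferentiableAt ℝ (fun y ↦ G₁ (τ y)) (F q) := hG₁.comp (F q) hτ1
    rw [h1, h2.fderiv_eq, fderiv_bilin_apply hc (by fun_prop) (by fun_prop),
      fderiv_comp_apply hG₁ hτ1, fderiv_fderiv_apply hτ, fderiv_fderiv_apply hτ]
  have hFq : F₁ q = τ (F q) := hF₁.self_of_nhds
  have hAq : A₁ q = fderiv ℝ τ (F q) (A q) := hA₁.self_of_nhds
  have hdF : fderiv ℝ F₁ q w = fderiv ℝ τ (F q) (fderiv ℝ F q w) := by
    rw [hF₁.fderiv_eq, fderiv_comp_apply hτ1 hF]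
  have hdA : fderiv ℝ A₁ q w = fderiv ℝ (fderiv ℝ τ) (F q) (fderiv ℝ F q w) (A q) +
      fderiv ℝ τ (F q) (fderiv ℝ A q w) := by
    have hc : DifferentiableAt ℝ (fun x ↦ fderiv ℝ τ (F x)) q := hτ'.comp q hF
    rw [hA₁.fderiv_eq, fderiv_clm_apply hc hA]
    simp [fderiv_comp_apply hτ' hF, add_comm]
  rw [lowerCov_apply, lowerCov_apply, christoffelFst_apply, christoffelFst_apply, hFq, hAq, hdF,
    hdA, hd, hd, hd, hG.self_of_nhds, map_add, add_apply,
    hτ'' (A q) (fderiv ℝ F q w), hτ'' c, hτ'' c,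
    hs.self_of_nhds (fderiv ℝ (fderiv ℝ τ) (F q) (fderiv ℝ F q w) c)]
  ring

/-- The second derivatives of the coefficients of the induced metric. -/
theorem fderiv_fderiv_bilin {G : E → E →L[ℝ] E →L[ℝ] ℝ} {F : P → E} {q : P}
    (hG : ContDiffAt ℝ ∞ G (F q)) (hF : ContDiffAt ℝ ∞ F q) (a b w z : P) :
    let d : P → P → E := fun a w ↦ fderiv ℝ (fun x ↦ fderiv ℝ F x a) q w
    let t : P → P → P → E := fun a w z ↦
      fderiv ℝ (fun x ↦ fderiv ℝ (fun x ↦ fderiv ℝ F x a) x w) q z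
    let e : P → E := fun a ↦ fderiv ℝ F q a
    let g := G (F q)
    let g' := fderiv ℝ G (F q)
    fderiv ℝ (fun x ↦ fderiv ℝ (fun x ↦ G (F x) (fderiv ℝ F x a) (fderiv ℝ F x b)) x w) q z =
      fderiv ℝ (fderiv ℝ G) (F q) (e z) (e w) (e a) (e b) +
      g' (d w z) (e a) (e b) + g' (e w) (d a z) (e b) + g' (e w) (e a) (d b z) +
      (g' (e z) (d a w) (e b) + g (t a w z) (e b) + g (d a w) (d b z)) +
      (g' (e z) (e a) (d b w) + g (d a z) (d b w) + g (e a) (t b w z)) := by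
  intro d t e g g'
  have hF' : ∀ a, ContDiffAt ℝ ∞ (fun x ↦ fderiv ℝ F x a) q := fun a ↦
    (hF.fderiv_right (m := ∞) (by norm_num)).clm_apply contDiffAt_const
  have hF'' : ∀ a w, ContDiffAt ℝ ∞ (fun x ↦ fderiv ℝ (fun x ↦ fderiv ℝ F x a) x w) q := fun a w ↦
    ((hF' a).fderiv_right (m := ∞) (by norm_num)).clm_apply contDiffAt_const
  have hG' : ContDiffAt ℝ ∞ (fderiv ℝ G) (F q) := hG.fderiv_right (m := ∞) (by norm_num)
  have hGF : ContDiffAt ℝ ∞ (fun x ↦ G (F x)) q := hG.comp q hF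
  have hGF' : ContDiffAt ℝ ∞ (fun x ↦ fderiv ℝ G (F x)) q := hG'.comp q hF
  have hi : (∞ : WithTop ℕ∞) ≠ 0 := by simp
  -- The first derivative is needed on a whole neighbourhood of `q`, because it is differentiated
  -- once more.
  have h1 : (fun x ↦ fderiv ℝ (fun x ↦ G (F x) (fderiv ℝ F x a) (fderiv ℝ F x b)) x w) =ᶠ[𝓝 q]
      fun x ↦ fderiv ℝ G (F x) (fderiv ℝ F x w) (fderiv ℝ F x a) (fderiv ℝ F x b) +
        G (F x) (fderiv ℝ (fun x ↦ fderiv ℝ F x a) x w) (fderiv ℝ F x b) +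
        G (F x) (fderiv ℝ F x a) (fderiv ℝ (fun x ↦ fderiv ℝ F x b) x w) := by
    have ev1 : ∀ᶠ x in 𝓝 q, ContDiffAt ℝ 2 F x :=
      (hF.of_le (m := 2) ENat.LEInfty.out).eventually (by simp)
    have ev2 : ∀ᶠ x in 𝓝 q, ContDiffAt ℝ 1 G (F x) := hF.continuousAt.eventually
      ((hG.of_le (m := 1) ENat.LEInfty.out).eventually (by simp))
    filter_upwards [ev1, ev2] with x hx hy
    have hx1 : DifferentiableAt ℝ F x := hx.differentiableAt (by norm_num)
    have hx2 : ∀ a, DifferentiableAt ℝ (fun x ↦ fderiv ℝ F x a) x := fun a ↦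
      ((hx.fderiv_right (m := 1) (by norm_num)).clm_apply contDiffAt_const).differentiableAt
        (by norm_num)
    have hy1 : DifferentiableAt ℝ G (F x) := hy.differentiableAt (by norm_num)
    have hc : DifferentiableAt ℝ (fun y ↦ G (F y)) x := hy1.comp x hx1
    rw [fderiv_bilin_apply hc (hx2 a) (hx2 b), fderiv_comp_apply hy1 hx1]
  have hc1 : DifferentiableAt ℝ (fun x ↦ fderiv ℝ G (F x) (fderiv ℝ F x w)) q :=
    (hGF'.clm_apply (hF' w)).differentiableAt hi
  have hdF : ∀ a, DifferentiableAt ℝ (fun x ↦ fderiv ℝ F x a) q := fun a ↦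
    (hF' a).differentiableAt hi
  have hdF' : ∀ a w, DifferentiableAt ℝ (fun x ↦ fderiv ℝ (fun x ↦ fderiv ℝ F x a) x w) q :=
    fun a w ↦ (hF'' a w).differentiableAt hi
  have hdG : DifferentiableAt ℝ (fun x ↦ G (F x)) q := hGF.differentiableAt hi
  have hdG' : DifferentiableAt ℝ (fun x ↦ fderiv ℝ G (F x)) q := hGF'.differentiableAt hi
  have hdF0 : DifferentiableAt ℝ F q := hF.differentiableAt hi
  have t1 := (hc1.clm_apply (hdF a)).clm_apply (hdF b)
  have t2 := (hdG.clm_apply (hdF' a w)).clm_apply (hdF b)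
  have t3 := (hdG.clm_apply (hdF a)).clm_apply (hdF' b w)
  rw [h1.fderiv_eq, fderiv_fun_add (t1.fun_add t2) t3, fderiv_fun_add t1 t2, add_apply, add_apply,
    fderiv_bilin_apply hc1 (hdF a) (hdF b), fderiv_bilin_apply hdG (hdF' a w) (hdF b),
    fderiv_bilin_apply hdG (hdF a) (hdF' b w), fderiv_comp_apply (hG.differentiableAt hi) hdF0,
    fderiv_clm_apply hdG' (hdF w)]
  simp only [add_apply, ContinuousLinearMap.comp_apply,
    ContinuousLinearMap.flip_apply, fderiv_comp_apply (hG'.differentiableAt hi) hdF0]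
  simp only [d, t, e, g, g']
  ring

/-- The Christoffel symbols of the second kind. -/
def christoffelSnd (G : E → E →L[ℝ] E →L[ℝ] ℝ) (y a b : E) : E :=
  (G y).inverse (christoffelFst G y a b)

theorem metric_christoffelSnd {G : E → E →L[ℝ] E →L[ℝ] ℝ} {y : E} (hG : (G y).IsInvertible)
    (a b : E) : G y (christoffelSnd G y a b) = christoffelFst G y a b := by
  obtain ⟨e, he⟩ := hG
  rw [christoffelSnd, ← he, ContinuousLinearMap.inverse_equiv]
  exact e.apply_symm_apply _

theorem christoffelSnd_symm {G : E → E →L[ℝ] E →L[ℝ] ℝ} {y : E} (hG : DifferentiableAt ℝ G y)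
    (hs : ∀ᶠ z in 𝓝 y, ∀ a b, G z a b = G z b a) (a b : E) :
    christoffelSnd G y a b = christoffelSnd G y b a := by
  rw [christoffelSnd, christoffelSnd, christoffelFst_symm hG hs]

/-- The covariant derivative in the direction `w` of a vector field `A` along `F`. -/
def coordCov (G : E → E →L[ℝ] E →L[ℝ] ℝ) (F A : P → E) (w q : P) : E :=
  fderiv ℝ A q w + christoffelSnd G (F q) (fderiv ℝ F q w) (A q)

theorem metric_coordCov {G : E → E →L[ℝ] E →L[ℝ] ℝ} {F A : P → E} {w q : P}
    (hG : (G (F q)).IsInvertible) : G (F q) (coordCov G F A w q) = lowerCov G F A w q := by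
  rw [coordCov, map_add, metric_christoffelSnd hG]
  rfl

/-- The quadrilinear form whose biquadratic form is the Riemann curvature tensor of `G`. -/
def curvatureForm (G : E → E →L[ℝ] E →L[ℝ] ℝ) (y a b c d : E) : ℝ :=
  fderiv ℝ (fderiv ℝ G) y a b c d + G y (christoffelSnd G y a b) (christoffelSnd G y c d)

/-- The second derivatives of the first fundamental form: the Gauss equation. -/
theorem gauss_equation {G : E → E →L[ℝ] E →L[ℝ] ℝ} {F : P → E} {q : P}
    (hG : ContDiffAt ℝ ∞ G (F q)) (hF : ContDiffAt ℝ ∞ F q)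
    (hs : ∀ᶠ z in 𝓝 (F q), ∀ a b, G z a b = G z b a) (hi : (G (F q)).IsInvertible) (u v : P) :
    let h : P → P → P → ℝ := fun a b x ↦ G (F x) (fderiv ℝ F x a) (fderiv ℝ F x b)
    let D : P → P → E := fun a b ↦ coordCov G F (fun x ↦ fderiv ℝ F x a) b q;
    -(1 / 2) * fderiv ℝ (fun x ↦ fderiv ℝ (h u u) x v) q v +
        fderiv ℝ (fun x ↦ fderiv ℝ (h u v) x v) q u -
        (1 / 2) * fderiv ℝ (fun x ↦ fderiv ℝ (h v v) x u) q u =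
      G (F q) (D u u) (D v v) - G (F q) (D u v) (D u v) +
        sectional (curvatureForm G (F q)) (fderiv ℝ F q u) (fderiv ℝ F q v) := by
  intro h D
  have hF2 : ContDiffAt ℝ 2 F q := hF.of_le ENat.LEInfty.out
  have hF' : ∀ a, ContDiffAt ℝ 2 (fun x ↦ fderiv ℝ F x a) q := fun a ↦
    ((hF.fderiv_right (m := ∞) (by norm_num)).clm_apply contDiffAt_const).of_le ENat.LEInfty.out
  have hdG : DifferentiableAt ℝ G (F q) := hG.differentiableAt (by simp)
  have comm : ∀ a b, (fun x ↦ fderiv ℝ (fun x ↦ fderiv ℝ F x a) x b) =ᶠ[𝓝 q] fun x ↦ fderiv ℝ (fun x ↦ fderiv ℝ F x b) x a := fun a b ↦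
    (hF2.eventually (by simp)).mono fun x hx ↦ fderiv_fderiv_comm hx a b
  -- All third derivatives are brought to the two forms `F_uuv` and `F_uvv`, whose contributions
  -- then cancel among the three second derivatives of the metric.
  have e1 : ∀ a, fderiv ℝ (fun x ↦ fderiv ℝ (fun x ↦ fderiv ℝ F x v) x u) q a =
      fderiv ℝ (fun x ↦ fderiv ℝ (fun x ↦ fderiv ℝ F x u) x v) q a := fun a ↦ by
    rw [(comm u v).fderiv_eq]
  have e2 : fderiv ℝ (fun x ↦ fderiv ℝ (fun x ↦ fderiv ℝ F x v) x v) q u =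
      fderiv ℝ (fun x ↦ fderiv ℝ (fun x ↦ fderiv ℝ F x u) x v) q v := by
    rw [fderiv_fderiv_comm (hF' v) v u, e1]
  simp only [h]
  rw [fderiv_fderiv_bilin hG hF, fderiv_fderiv_bilin hG hF, fderiv_fderiv_bilin hG hF]
  have hsq := hs.self_of_nhds
  simp only [D, coordCov, map_add, add_apply, metric_christoffelSnd hi, sectional, curvatureForm,
    fderiv_fderiv_comm hF2 v u, e1, e2]
  simp only [hsq _ (christoffelSnd G (F q) _ _), metric_christoffelSnd hi, christoffelFst_apply]
  rw [christoffelSnd_symm hdG hs (fderiv ℝ F q v) (fderiv ℝ F q u)]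
  -- Both sides equal `G (Γ(u,u)) (Γ(v,v))`. This is the one relation between Christoffel terms that
  -- multilinear expansion cannot see.
  have hk : christoffelFst G (F q) (fderiv ℝ F q u) (fderiv ℝ F q u)
        (christoffelSnd G (F q) (fderiv ℝ F q v) (fderiv ℝ F q v)) =
      christoffelFst G (F q) (fderiv ℝ F q v) (fderiv ℝ F q v)
        (christoffelSnd G (F q) (fderiv ℝ F q u) (fderiv ℝ F q u)) := by
    rw [← metric_christoffelSnd hi, ← metric_christoffelSnd hi, hsq]
  rw [christoffelFst_apply, christoffelFst_apply] at hk
  have S := fderiv_bilin_symm hdG hs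
  generalize fderiv ℝ (fun x ↦ fderiv ℝ (fun x ↦ fderiv ℝ F x u) x v) q u = T₁
  generalize fderiv ℝ (fun x ↦ fderiv ℝ (fun x ↦ fderiv ℝ F x u) x v) q v = T₂
  generalize fderiv ℝ (fun x ↦ fderiv ℝ F x u) q u = d₁₁
  generalize fderiv ℝ (fun x ↦ fderiv ℝ F x u) q v = d₁₂
  generalize fderiv ℝ (fun x ↦ fderiv ℝ F x v) q v = d₂₂
  generalize fderiv ℝ F q u = d₁ at hk ⊢
  generalize fderiv ℝ F q v = d₂ at hk ⊢
  simp only [S _ d₁₁ d₂, S _ d₁₂ d₁, S _ d₁₂ d₂, S _ d₂ d₁, hsq T₁ d₂, hsq T₂ d₁]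
  linear_combination (-1 / 2) * hk

end Calculus

end MetricGeometry

/-! ### Passage between the manifold and its charts -/

section Chart

variable {M : Type*} [TopologicalSpace M] [ChartedSpace E3 M] [IsManifold 𝓘(ℝ, E3) ∞ M]

/-- A map from the plane to `M`, read in the chart at `x`. -/
def coordMap (x : M) (f : ℝ × ℝ → M) (q : ℝ × ℝ) : E3 := extChartAt 𝓘(ℝ, E3) x (f q)

/-- The coordinates of a tangent vector at `y` in the chart at `x`. -/
def coords (x y : M) : TangentSpace 𝓘(ℝ, E3) y →L[ℝ] E3 :=
  (trivializationAt E3 (TangentSpace 𝓘(ℝ, E3)) x).continuousLinearMapAt ℝ y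

/-- The tangent vector at `y` with given coordinates in the chart at `x`. -/
def frame (x y : M) : E3 →L[ℝ] TangentSpace 𝓘(ℝ, E3) y :=
  (trivializationAt E3 (TangentSpace 𝓘(ℝ, E3)) x).symmL ℝ y

theorem coords_eq {x y : M} (h : y ∈ (chartAt E3 x).source) (v : TangentSpace 𝓘(ℝ, E3) y) :
    coords x y v = (trivializationAt E3 (TangentSpace 𝓘(ℝ, E3)) x ⟨y, v⟩).2 := by
  rw [coords, Bundle.Trivialization.continuousLinearMapAt_apply,
    Bundle.Trivialization.linearMapAt_apply, if_pos (by simpa using h)]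

theorem frame_coords {x y : M} (h : y ∈ (chartAt E3 x).source) (v : TangentSpace 𝓘(ℝ, E3) y) :
    frame x y (coords x y v) = v :=
  Bundle.Trivialization.symmL_continuousLinearMapAt _ (by simpa using h) v

theorem coords_frame {x y : M} (h : y ∈ (chartAt E3 x).source) (v : E3) :
    coords x y (frame x y v) = v :=
  Bundle.Trivialization.continuousLinearMapAt_symmL _ (by simpa using h) v

theorem coords_eq_mfderiv {x y : M} (h : y ∈ (chartAt E3 x).source) :
    coords x y = mfderiv 𝓘(ℝ, E3) 𝓘(ℝ, E3) (extChartAt 𝓘(ℝ, E3) x) y :=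
  TangentBundle.continuousLinearMapAt_trivializationAt h

/-- The tangent space at `x` is identified with `E3` through the preferred chart at `x`, so the
coordinate change involved is the identity. -/
theorem coords_self (x : M) (v : TangentSpace 𝓘(ℝ, E3) x) : coords x x v = v := by
  rw [coords, TangentBundle.continuousLinearMapAt_trivializationAt_eq_core (mem_chart_source _ _)]
  exact (tangentBundleCore 𝓘(ℝ, E3) M).coordChange_self (achart E3 x) x (mem_chart_source _ _) v

theorem frame_self (x : M) (v : E3) : frame x x v = v := by
  conv_lhs => rw [← coords_self x (v : TangentSpace 𝓘(ℝ, E3) x)]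
  exact frame_coords (mem_chart_source _ _) _

theorem mdifferentiableAt_chart {x y : M} (h : y ∈ (chartAt E3 x).source) :
    MDifferentiableAt 𝓘(ℝ, E3) 𝓘(ℝ, E3) (extChartAt 𝓘(ℝ, E3) x) y :=
  mdifferentiableAt_extChartAt h

/-- The coordinates of a velocity vector. -/
theorem coords_vel {x : M} {f : ℝ × ℝ → M} {q : ℝ × ℝ} (h : f q ∈ (chartAt E3 x).source)
    (hf : MDifferentiableAt 𝓘(ℝ, ℝ × ℝ) 𝓘(ℝ, E3) f q) (w : ℝ × ℝ) :
    coords x (f q) (vel f w q) = fderiv ℝ (coordMap x f) q w := by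
  rw [coords_eq_mfderiv h, vel, ← mfderiv_eq_fderiv]
  exact (mfderiv_comp_apply q (mdifferentiableAt_chart h) hf w).symm

/-- The coordinates of a vector field along a map from the plane to `M`. -/
def coordVec (x : M) (f : ℝ × ℝ → M) (V : ∀ q, TangentSpace 𝓘(ℝ, E3) (f q)) (q : ℝ × ℝ) : E3 :=
  coords x (f q) (V q)

theorem coordVec_vel_eventuallyEq {x : M} {f : ℝ × ℝ → M} {q : ℝ × ℝ}
    (h : f q ∈ (chartAt E3 x).source)
    (hf : ContMDiffAt 𝓘(ℝ, ℝ × ℝ) 𝓘(ℝ, E3) ∞ f q) (w : ℝ × ℝ) :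
    coordVec x f (vel f w) =ᶠ[𝓝 q] fun q' ↦ fderiv ℝ (coordMap x f) q' w := by
  have h1 : ∀ᶠ q' in 𝓝 q, f q' ∈ (chartAt E3 x).source :=
    hf.continuousAt.eventually ((chartAt E3 x).open_source.mem_nhds h)
  have h2 : ∀ᶠ q' in 𝓝 q, ContMDiffAt 𝓘(ℝ, ℝ × ℝ) 𝓘(ℝ, E3) 1 f q' :=
    (contMDiffAt_iff_contMDiffAt_nhds (by simp)).1 (hf.of_le ENat.LEInfty.out)
  filter_upwards [h1, h2] with q' h1 h2
  exact coords_vel h1 (h2.mdifferentiableAt (by norm_num)) w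

theorem contDiffAt_coordMap {x : M} {f : ℝ × ℝ → M} {q : ℝ × ℝ}
    (h : f q ∈ (chartAt E3 x).source) (hf : ContMDiffAt 𝓘(ℝ, ℝ × ℝ) 𝓘(ℝ, E3) ∞ f q) :
    ContDiffAt ℝ ∞ (coordMap x f) q :=
  ((contMDiffAt_extChartAt' (I := 𝓘(ℝ, E3)) (n := ∞) h).comp q hf).contDiffAt

theorem contDiffAt_coordVec {x : M} {f : ℝ × ℝ → M} {V : ∀ q, TangentSpace 𝓘(ℝ, E3) (f q)}
    {q : ℝ × ℝ} (h : f q ∈ (chartAt E3 x).source)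
    (hV : ContMDiffAt 𝓘(ℝ, ℝ × ℝ) 𝓘(ℝ, E3).tangent ∞
      (fun q ↦ (⟨f q, V q⟩ : TangentBundle 𝓘(ℝ, E3) M)) q) :
    ContDiffAt ℝ ∞ (coordVec x f V) q := by
  have hmem : (⟨f q, V q⟩ : TangentBundle 𝓘(ℝ, E3) M) ∈
      (trivializationAt E3 (TangentSpace 𝓘(ℝ, E3)) x).source := by
    rw [Bundle.Trivialization.mem_source]; simpa using h
  obtain ⟨h1, h2⟩ := (Bundle.Trivialization.contMDiffAt_iff
    (f := fun q ↦ (⟨f q, V q⟩ : TangentBundle 𝓘(ℝ, E3) M)) hmem).1 hV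
  refine h2.contDiffAt.congr_of_eventuallyEq ?_
  filter_upwards [h1.continuousAt.eventually ((chartAt E3 x).open_source.mem_nhds h)] with q' hq'
  exact coords_eq hq' _

/-- The change of coordinates from the chart at `x` to the chart at `x'`. -/
def chartChange (x x' : M) : E3 → E3 :=
  extChartAt 𝓘(ℝ, E3) x' ∘ (extChartAt 𝓘(ℝ, E3) x).symm

theorem contDiffAt_chartChange {x x' y : M} (h : y ∈ (chartAt E3 x).source)
    (h' : y ∈ (chartAt E3 x').source) :
    ContDiffAt ℝ ∞ (chartChange x x') (extChartAt 𝓘(ℝ, E3) x y) := by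
  have hmem : extChartAt 𝓘(ℝ, E3) x y ∈ (extChartAt 𝓘(ℝ, E3) x).target :=
    (extChartAt 𝓘(ℝ, E3) x).map_source (by simpa using h)
  have h1 : ContMDiffAt 𝓘(ℝ, E3) 𝓘(ℝ, E3) ∞ (extChartAt 𝓘(ℝ, E3) x).symm
      (extChartAt 𝓘(ℝ, E3) x y) :=
    (contMDiffOn_extChartAt_symm x).contMDiffAt ((isOpen_extChartAt_target x).mem_nhds hmem)
  have hy : (extChartAt 𝓘(ℝ, E3) x).symm (extChartAt 𝓘(ℝ, E3) x y) = y :=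
    (extChartAt 𝓘(ℝ, E3) x).left_inv (by simpa using h)
  have h2 : ContMDiffAt 𝓘(ℝ, E3) 𝓘(ℝ, E3) ∞ (extChartAt 𝓘(ℝ, E3) x')
      ((extChartAt 𝓘(ℝ, E3) x).symm (extChartAt 𝓘(ℝ, E3) x y)) := by
    rw [hy]
    exact contMDiffAt_extChartAt' h'
  exact (h2.comp _ h1).contDiffAt

theorem fderiv_chartChange {x x' y : M} (h : y ∈ (chartAt E3 x).source)
    (h' : y ∈ (chartAt E3 x').source) (v : TangentSpace 𝓘(ℝ, E3) y) :
    fderiv ℝ (chartChange x x') (extChartAt 𝓘(ℝ, E3) x y) (coords x y v) = coords x' y v := by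
  rw [coords_eq_mfderiv h, coords_eq_mfderiv h', ← mfderiv_eq_fderiv]
  have hd := (contDiffAt_chartChange h h').differentiableAt (by simp)
  refine (mfderiv_comp_apply y hd.mdifferentiableAt (mdifferentiableAt_chart h) v).symm.trans ?_
  have : chartChange x x' ∘ extChartAt 𝓘(ℝ, E3) x =ᶠ[𝓝 y] extChartAt 𝓘(ℝ, E3) x' := by
    filter_upwards [(chartAt E3 x).open_source.mem_nhds h] with z hz
    rw [Function.comp_apply, chartChange, Function.comp_apply,
      (extChartAt 𝓘(ℝ, E3) x).left_inv (by simpa using hz)]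
  rw [this.mfderiv_eq]
  rfl

section Metric

variable [RiemannianBundle (fun x : M ↦ TangentSpace 𝓘(ℝ, E3) x)]

theorem chartMetric_apply (x : M) {y : M} (h : y ∈ (chartAt E3 x).source) (a b : E3) :
    chartMetric x (extChartAt 𝓘(ℝ, E3) x y) a b = ⟪frame x y a, frame x y b⟫ := by
  have : (extChartAt 𝓘(ℝ, E3) x).symm (extChartAt 𝓘(ℝ, E3) x y) = y :=
    (extChartAt 𝓘(ℝ, E3) x).left_inv (by simpa using h)
  simp only [chartMetric]
  rw [this]
  rfl

theorem chartMetric_apply' (x : M) (y : E3) (a b : E3) :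
    chartMetric x y a b = ⟪frame x ((extChartAt 𝓘(ℝ, E3) x).symm y) a,
      frame x ((extChartAt 𝓘(ℝ, E3) x).symm y) b⟫ := rfl

theorem chartMetric_coords (x : M) {y : M} (h : y ∈ (chartAt E3 x).source)
    (v w : TangentSpace 𝓘(ℝ, E3) y) :
    chartMetric x (extChartAt 𝓘(ℝ, E3) x y) (coords x y v) (coords x y w) = ⟪v, w⟫ := by
  rw [chartMetric_apply x h, frame_coords h, frame_coords h]

theorem chartMetric_symm (x : M) (y a b : E3) : chartMetric x y a b = chartMetric x y b a := by
  rw [chartMetric_apply', chartMetric_apply', real_inner_comm]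

theorem isInvertible_chartMetric (x : M) {y : M} (h : y ∈ (chartAt E3 x).source) :
    (chartMetric x (extChartAt 𝓘(ℝ, E3) x y)).IsInvertible := by
  have inj : Function.Injective (chartMetric x (extChartAt 𝓘(ℝ, E3) x y)) := by
    rw [injective_iff_map_eq_zero]
    intro a ha
    have h0 : ⟪frame x y a, frame x y a⟫ = 0 := by
      rw [← chartMetric_apply x h, ha]; rfl
    rw [inner_self_eq_zero] at h0
    rw [← coords_frame h a, h0, map_zero]
  have hfin : Module.finrank ℝ E3 = Module.finrank ℝ (E3 →L[ℝ] ℝ) :=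
    (InnerProductSpace.toDual ℝ E3).toLinearEquiv.finrank_eq
  have : FiniteDimensional ℝ (E3 →L[ℝ] ℝ) :=
    (InnerProductSpace.toDual ℝ E3).toLinearEquiv.finiteDimensional
  exact ⟨(LinearEquiv.ofInjectiveOfFinrankEq _ inj hfin).toContinuousLinearEquiv, by ext; rfl⟩

theorem inner_christoffel (x : M) (a b c : TangentSpace 𝓘(ℝ, E3) x) :
    ⟪christoffel x a b, c⟫ =
      christoffelFst (E := E3) (chartMetric x) (extChartAt 𝓘(ℝ, E3) x x) a b c := by
  rw [christoffel]
  exact InnerProductSpace.toDual_symm_apply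

/-- In the chart at `f q` the definition of `covDeriv` is already the coordinate formula. Pairing
with `c` undoes the dualization in `christoffel`. -/
theorem inner_covDeriv_chart_self {f : ℝ × ℝ → M} {V : ∀ q, TangentSpace 𝓘(ℝ, E3) (f q)}
    {q : ℝ × ℝ} (hf : MDifferentiableAt 𝓘(ℝ, ℝ × ℝ) 𝓘(ℝ, E3) f q) (w : ℝ × ℝ)
    (c : TangentSpace 𝓘(ℝ, E3) (f q)) :
    ⟪covDeriv f V w q, c⟫ =
      lowerCov (chartMetric (f q)) (coordMap (f q) f) (coordVec (f q) f V) w q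
        (coords (f q) (f q) c) := by
  have hmem := mem_chart_source E3 (f q)
  have hV : (fun q' ↦ (trivializationAt E3 (TangentSpace 𝓘(ℝ, E3)) (f q) ⟨f q', V q'⟩).2) =ᶠ[𝓝 q]
      coordVec (f q) f V := by
    filter_upwards [hf.continuousAt.eventually ((chartAt E3 (f q)).open_source.mem_nhds hmem)]
      with q' hq'
    exact (coords_eq hq' _).symm
  have h1 : coords (f q) (f q) (christoffel (f q) (vel f w q) (V q)) =
      christoffel (f q) (vel f w q) (V q) := coords_self _ _
  have h2 := chartMetric_coords (f q) hmem (frame (f q) (f q) (fderiv ℝ (coordVec (f q) f V) q w)) c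
  rw [coords_frame hmem] at h2
  have h3 : covDeriv f V w q = frame (f q) (f q) (fderiv ℝ (coordVec (f q) f V) q w) +
      christoffel (f q) (vel f w q) (V q) := by
    rw [frame_self, covDeriv, hV.fderiv_eq]
  rw [lowerCov_apply, h3, inner_add_left, inner_christoffel, ← coords_vel hmem hf, coordVec,
    coords_self, coords_self, coords_self, ← h2, coords_self]
  rfl

section Smooth

variable [IsContMDiffRiemannianBundle 𝓘(ℝ, E3) ∞ E3 (fun x : M ↦ TangentSpace 𝓘(ℝ, E3) x)]

/-- Each coefficient is the inner product of two coordinate frame fields along the inverse chart.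
These are smooth sections, and the bundle metric is smooth. -/
theorem contDiffAt_chartMetric (x : M) {y : M} (h : y ∈ (chartAt E3 x).source) :
    ContDiffAt ℝ ∞ (chartMetric x) (extChartAt 𝓘(ℝ, E3) x y) := by
  have hopen : IsOpen (extChartAt 𝓘(ℝ, E3) x).target := isOpen_extChartAt_target x
  have hmem : extChartAt 𝓘(ℝ, E3) x y ∈ (extChartAt 𝓘(ℝ, E3) x).target :=
    (extChartAt 𝓘(ℝ, E3) x).map_source (by simpa using h)
  suffices H : ContDiffOn ℝ ∞ (chartMetric x) (extChartAt 𝓘(ℝ, E3) x).target from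
    H.contDiffAt (hopen.mem_nhds hmem)
  rw [contDiffOn_clm_apply]
  intro a
  rw [contDiffOn_clm_apply]
  intro b
  have hc := contMDiffOn_extChartAt_symm (I := 𝓘(ℝ, E3)) (n := ∞) x
  have hs : ∀ a : E3, ContMDiffOn 𝓘(ℝ, E3) 𝓘(ℝ, E3).tangent ∞
      (fun y ↦ (⟨(extChartAt 𝓘(ℝ, E3) x).symm y, frame x ((extChartAt 𝓘(ℝ, E3) x).symm y) a⟩ :
        TangentBundle 𝓘(ℝ, E3) M)) (extChartAt 𝓘(ℝ, E3) x).target := by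
    intro a
    have he := Bundle.Trivialization.contMDiffOn_symm (n := ∞) (IB := 𝓘(ℝ, E3))
      (trivializationAt E3 (TangentSpace 𝓘(ℝ, E3)) x)
    have hp : ContMDiffOn 𝓘(ℝ, E3) (𝓘(ℝ, E3).prod 𝓘(ℝ, E3)) ∞
        (fun y ↦ ((extChartAt 𝓘(ℝ, E3) x).symm y, a)) (extChartAt 𝓘(ℝ, E3) x).target :=
      hc.prodMk contMDiffOn_const
    have hin : ∀ y ∈ (extChartAt 𝓘(ℝ, E3) x).target, (extChartAt 𝓘(ℝ, E3) x).symm y ∈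
        (trivializationAt E3 (TangentSpace 𝓘(ℝ, E3)) x).baseSet := by
      intro y hy
      simpa using (extChartAt 𝓘(ℝ, E3) x).map_target hy
    refine (he.comp hp fun y hy ↦ ?_).congr fun y hy ↦ ?_
    · rw [Set.mem_preimage, Bundle.Trivialization.mem_target]
      exact hin y hy
    · rw [Function.comp_apply]
      rw [frame, Bundle.Trivialization.symmL_apply, Bundle.Trivialization.mk_symm _ (hin y hy)]
      exact hin y hy
  have := (hs a).inner_bundle (hs b)
  exact this.contDiffOn

/-- The covariant derivative can be computed in any chart. -/
theorem inner_covDeriv {x : M} {f : ℝ × ℝ → M} {V : ∀ q, TangentSpace 𝓘(ℝ, E3) (f q)}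
    {q : ℝ × ℝ} (h : f q ∈ (chartAt E3 x).source)
    (hf : MDifferentiableAt 𝓘(ℝ, ℝ × ℝ) 𝓘(ℝ, E3) f q)
    (hV : DifferentiableAt ℝ (coordVec x f V) q) (w : ℝ × ℝ) (c : TangentSpace 𝓘(ℝ, E3) (f q)) :
    ⟪covDeriv f V w q, c⟫ =
      lowerCov (chartMetric x) (coordMap x f) (coordVec x f V) w q (coords x (f q) c) := by
  have hmem := mem_chart_source E3 (f q)
  have hsymm : ∀ z : M, z ∈ (chartAt E3 x).source →
      (extChartAt 𝓘(ℝ, E3) x).symm (extChartAt 𝓘(ℝ, E3) x z) = z := fun z hz ↦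
    (extChartAt 𝓘(ℝ, E3) x).left_inv (by simpa using hz)
  have hτq : chartChange x (f q) (coordMap x f q) = extChartAt 𝓘(ℝ, E3) (f q) (f q) := by
    rw [chartChange, Function.comp_apply, coordMap, hsymm _ h]
  have hx : ∀ᶠ q' in 𝓝 q, f q' ∈ (chartAt E3 x).source :=
    hf.continuousAt.eventually ((chartAt E3 x).open_source.mem_nhds h)
  have hq : ∀ᶠ q' in 𝓝 q, f q' ∈ (chartAt E3 (f q)).source :=
    hf.continuousAt.eventually ((chartAt E3 (f q)).open_source.mem_nhds hmem)
  have hcF : DifferentiableAt ℝ (coordMap x f) q :=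
    ((mdifferentiableAt_chart h).comp q hf).differentiableAt
  have hG : ∀ᶠ y in 𝓝 (coordMap x f q), ∀ a b, chartMetric x y a b =
      chartMetric (f q) (chartChange x (f q) y) (fderiv ℝ (chartChange x (f q)) y a)
        (fderiv ℝ (chartChange x (f q)) y b) := by
    have htgt : ∀ᶠ y in 𝓝 (coordMap x f q), y ∈ (extChartAt 𝓘(ℝ, E3) x).target :=
      (isOpen_extChartAt_target x).mem_nhds
        ((extChartAt 𝓘(ℝ, E3) x).map_source (by simpa using h))
    have hcont : ContinuousAt (extChartAt 𝓘(ℝ, E3) x).symm (coordMap x f q) :=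
      continuousAt_extChartAt_symm' (by simpa using h)
    have hsrc : ∀ᶠ y in 𝓝 (coordMap x f q),
        (extChartAt 𝓘(ℝ, E3) x).symm y ∈ (chartAt E3 (f q)).source := by
      refine hcont.eventually ((chartAt E3 (f q)).open_source.mem_nhds ?_)
      rw [coordMap, hsymm _ h]
      exact hmem
    filter_upwards [htgt, hsrc] with y hy hy' a b
    have hz : (extChartAt 𝓘(ℝ, E3) x).symm y ∈ (chartAt E3 x).source := by
      simpa using (extChartAt 𝓘(ℝ, E3) x).map_target hy
    have hr : extChartAt 𝓘(ℝ, E3) x ((extChartAt 𝓘(ℝ, E3) x).symm y) = y :=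
      (extChartAt 𝓘(ℝ, E3) x).right_inv hy
    have key : ∀ a, fderiv ℝ (chartChange x (f q)) y a =
        coords (f q) _ (frame x ((extChartAt 𝓘(ℝ, E3) x).symm y) a) := fun a ↦ by
      rw [← fderiv_chartChange hz hy', coords_frame hz, hr]
    rw [key, key, chartChange, Function.comp_apply, chartMetric_coords _ hy', chartMetric_apply']
  have hc : fderiv ℝ (chartChange x (f q)) (coordMap x f q) (coords x (f q) c) =
      coords (f q) (f q) c := by
    rw [coordMap, fderiv_chartChange h hmem]
  rw [inner_covDeriv_chart_self hf, lowerCov_change (τ := chartChange x (f q))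
    (G₁ := chartMetric (f q)) (F₁ := coordMap (f q) f) (A₁ := coordVec (f q) f V)
    ((contDiffAt_chartChange h hmem).of_le ENat.LEInfty.out) ?_ ?_ hG ?_ hcF hV ?_ ?_, hc]
  · rw [hτq]
    exact (contDiffAt_chartMetric (f q) hmem).differentiableAt (by simp)
  · exact Filter.Eventually.of_forall fun z ↦ chartMetric_symm (f q) z
  · exact (contDiffAt_chartMetric x h).differentiableAt (by simp)
  · filter_upwards [hx] with q' hx'
    rw [chartChange, Function.comp_apply, coordMap, coordMap, hsymm _ hx']
  · filter_upwards [hx, hq] with q' hx' hq'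
    rw [coordVec, coordVec, coordMap, fderiv_chartChange hx' hq']

/-- The chart used by `covDeriv` moves with the point. To study its smoothness in `q`, it has to be
expressed in one fixed chart. -/
theorem covDeriv_eq_frame {x : M} {f : ℝ × ℝ → M} {V : ∀ q, TangentSpace 𝓘(ℝ, E3) (f q)}
    {q : ℝ × ℝ} (h : f q ∈ (chartAt E3 x).source)
    (hf : MDifferentiableAt 𝓘(ℝ, ℝ × ℝ) 𝓘(ℝ, E3) f q)
    (hV : DifferentiableAt ℝ (coordVec x f V) q) (w : ℝ × ℝ) :
    covDeriv f V w q =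
      frame x (f q) (coordCov (chartMetric x) (coordMap x f) (coordVec x f V) w q) := by
  refine ext_inner_right (E := TangentSpace 𝓘(ℝ, E3) (f q)) ℝ fun c ↦ ?_
  rw [inner_covDeriv h hf hV, ← metric_coordCov (G := chartMetric x) (F := coordMap x f) (isInvertible_chartMetric x h)]
  exact (chartMetric_apply x h _ _).trans (by rw [frame_coords h])

end Smooth

end Metric

end Chart

/-! ### Linearity and symmetries of the curvature form -/

section CurvatureSymmetries

variable {P E : Type*} [NormedAddCommGroup P] [NormedSpace ℝ P] [NormedAddCommGroup E]
  [NormedSpace ℝ E]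

theorem christoffelFst_add_left (G : E → E →L[ℝ] E →L[ℝ] ℝ) (y a a' b : E) :
    christoffelFst G y (a + a') b = christoffelFst G y a b + christoffelFst G y a' b := by
  ext c
  simp only [christoffelFst_apply, map_add, add_apply]
  ring

theorem christoffelFst_smul_left (G : E → E →L[ℝ] E →L[ℝ] ℝ) (y : E) (r : ℝ) (a b : E) :
    christoffelFst G y (r • a) b = r • christoffelFst G y a b := by
  ext c
  simp only [christoffelFst_apply, map_smul, smul_apply, smul_eq_mul]
  ring

theorem christoffelSnd_add_left (G : E → E →L[ℝ] E →L[ℝ] ℝ) (y a a' b : E) :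
    christoffelSnd G y (a + a') b = christoffelSnd G y a b + christoffelSnd G y a' b := by
  rw [christoffelSnd, christoffelFst_add_left, map_add]
  rfl

theorem christoffelSnd_smul_left (G : E → E →L[ℝ] E →L[ℝ] ℝ) (y : E) (r : ℝ) (a b : E) :
    christoffelSnd G y (r • a) b = r • christoffelSnd G y a b := by
  rw [christoffelSnd, christoffelFst_smul_left, map_smul]
  rfl

theorem curvatureForm_add_left (G : E → E →L[ℝ] E →L[ℝ] ℝ) (y a a' b c d : E) :
    curvatureForm G y (a + a') b c d = curvatureForm G y a b c d + curvatureForm G y a' b c d := by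
  simp only [curvatureForm, christoffelSnd_add_left, map_add, add_apply]
  ring

theorem curvatureForm_smul_left (G : E → E →L[ℝ] E →L[ℝ] ℝ) (y : E) (r : ℝ) (a b c d : E) :
    curvatureForm G y (r • a) b c d = r * curvatureForm G y a b c d := by
  simp only [curvatureForm, christoffelSnd_smul_left, map_smul, smul_apply, smul_eq_mul]
  ring

theorem curvatureForm_add_third (G : E → E →L[ℝ] E →L[ℝ] ℝ) (y a b c c' d : E) :
    curvatureForm G y a b (c + c') d = curvatureForm G y a b c d + curvatureForm G y a b c' d := by
  simp only [curvatureForm, christoffelSnd_add_left, map_add, add_apply]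
  ring

theorem curvatureForm_smul_third (G : E → E →L[ℝ] E →L[ℝ] ℝ) (y : E) (r : ℝ) (a b c d : E) :
    curvatureForm G y a b (r • c) d = r * curvatureForm G y a b c d := by
  simp only [curvatureForm, christoffelSnd_smul_left, map_smul, smul_apply, smul_eq_mul]
  ring

theorem curvatureForm_symm_left {G : E → E →L[ℝ] E →L[ℝ] ℝ} {y : E} (hG : ContDiffAt ℝ 2 G y)
    (hs : ∀ᶠ z in 𝓝 y, ∀ a b, G z a b = G z b a) (a b c d : E) :
    curvatureForm G y a b c d = curvatureForm G y b a c d := by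
  rw [curvatureForm, curvatureForm, christoffelSnd_symm (hG.differentiableAt (by norm_num)) hs a b,
    (hG.isSymmSndFDerivAt (by simp)).eq a b]

theorem curvatureForm_symm_right {G : E → E →L[ℝ] E →L[ℝ] ℝ} {y : E} (hG : ContDiffAt ℝ 2 G y)
    (hs : ∀ᶠ z in 𝓝 y, ∀ a b, G z a b = G z b a) (a b c d : E) :
    curvatureForm G y a b c d = curvatureForm G y a b d c := by
  have hd : DifferentiableAt ℝ (fderiv ℝ G) y :=
    (hG.fderiv_right (m := 1) (by norm_num)).differentiableAt (by norm_num)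
  -- The field `∂_b G` is itself symmetric near `y`, so symmetry in the last two arguments passes to
  -- its derivative.
  have h := fderiv_bilin_symm (G := fun z ↦ fderiv ℝ G z b) (y := y) (by fun_prop)
    (by
      filter_upwards [hs.eventually_nhds, hG.eventually (by simp)] with z hz hz' x x'
      exact fderiv_bilin_symm (hz'.differentiableAt (by norm_num)) hz b x x') a c d
  rw [fderiv_fderiv_apply hG] at h
  rw [curvatureForm, curvatureForm, christoffelSnd_symm (hG.differentiableAt (by norm_num)) hs c d,
    h]

end CurvatureSymmetries

/-! ### Smooth dependence of the coordinate expressions -/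

section Smoothness

variable {P E : Type*} [NormedAddCommGroup P] [NormedSpace ℝ P] [NormedAddCommGroup E]
  [NormedSpace ℝ E] {G : E → E →L[ℝ] E →L[ℝ] ℝ} {F A : P → E} {q : P}

theorem contDiffAt_christoffelFst (hG : ContDiffAt ℝ ∞ G (F q)) (hF : ContDiffAt ℝ ∞ F q)
    {a b : P → E} (ha : ContDiffAt ℝ ∞ a q) (hb : ContDiffAt ℝ ∞ b q) :
    ContDiffAt ℝ ∞ (fun x ↦ christoffelFst G (F x) (a x) (b x)) q := by
  have hG' : ContDiffAt ℝ ∞ (fun x ↦ fderiv ℝ G (F x)) q :=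
    (hG.fderiv_right (m := ∞) (by norm_num)).comp q hF
  have hfl : ContDiffAt ℝ ∞ (fun x ↦ (fderiv ℝ G (F x)).flip) q :=
    ((ContinuousLinearMap.flipₗᵢ ℝ E E (E →L[ℝ] ℝ)).contDiff.contDiffAt).comp q hG'
  have hfl2 : ContDiffAt ℝ ∞ (fun x ↦ ((fderiv ℝ G (F x)).flip (a x)).flip) q :=
    ((ContinuousLinearMap.flipₗᵢ ℝ E E ℝ).contDiff.contDiffAt).comp q (hfl.clm_apply ha)
  exact ((((hG'.clm_apply ha).clm_apply hb).add
    ((hG'.clm_apply hb).clm_apply ha)).sub (hfl2.clm_apply hb)).const_smul (1 / 2 : ℝ)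

variable [CompleteSpace E]

theorem contDiffAt_christoffelSnd (hG : ContDiffAt ℝ ∞ G (F q)) (hi : (G (F q)).IsInvertible)
    (hF : ContDiffAt ℝ ∞ F q) {a b : P → E} (ha : ContDiffAt ℝ ∞ a q)
    (hb : ContDiffAt ℝ ∞ b q) :
    ContDiffAt ℝ ∞ (fun x ↦ christoffelSnd G (F x) (a x) (b x)) q := by
  obtain ⟨e, he⟩ := hi
  have h1 : ContDiffAt ℝ ∞ ContinuousLinearMap.inverse (G (F q)) := he ▸ contDiffAt_map_inverse e
  have h2 : ContDiffAt ℝ ∞ (fun x ↦ G (F x)) q := hG.comp q hF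
  have h3 : ContDiffAt ℝ ∞ (fun x ↦ (G (F x)).inverse) q := ContDiffAt.comp (g := ContinuousLinearMap.inverse) q h1 h2
  exact h3.clm_apply (contDiffAt_christoffelFst hG hF ha hb)

theorem contDiffAt_fderiv_apply {E : Type*} [NormedAddCommGroup E] [NormedSpace ℝ E] {A : P → E}
    (hA : ContDiffAt ℝ ∞ A q) (w : P) : ContDiffAt ℝ ∞ (fun x ↦ fderiv ℝ A x w) q :=
  (hA.fderiv_right (m := ∞) (by norm_num)).clm_apply contDiffAt_const

theorem contDiffAt_coordCov (hG : ContDiffAt ℝ ∞ G (F q)) (hi : (G (F q)).IsInvertible)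
    (hF : ContDiffAt ℝ ∞ F q) (hA : ContDiffAt ℝ ∞ A q) (w : P) :
    ContDiffAt ℝ ∞ (coordCov G F A w) q :=
  (contDiffAt_fderiv_apply hA w).add
    (contDiffAt_christoffelSnd hG hi hF (contDiffAt_fderiv_apply hF w) hA)

theorem contDiffAt_curvatureForm (hG : ContDiffAt ℝ ∞ G (F q)) (hi : (G (F q)).IsInvertible)
    (hF : ContDiffAt ℝ ∞ F q) {a b c d : P → E} (ha : ContDiffAt ℝ ∞ a q)
    (hb : ContDiffAt ℝ ∞ b q) (hc : ContDiffAt ℝ ∞ c q) (hd : ContDiffAt ℝ ∞ d q) :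
    ContDiffAt ℝ ∞ (fun x ↦ curvatureForm G (F x) (a x) (b x) (c x) (d x)) q := by
  have h1 : ContDiffAt ℝ ∞ (fun x ↦ fderiv ℝ (fderiv ℝ G) (F x)) q :=
    ((hG.fderiv_right (m := ∞) (by norm_num)).fderiv_right (m := ∞) (by norm_num)).comp q hF
  have h2 : ContDiffAt ℝ ∞ (fun x ↦ G (F x)) q := hG.comp q hF
  exact ((((h1.clm_apply ha).clm_apply hb).clm_apply hc).clm_apply hd).add
    ((h2.clm_apply (contDiffAt_christoffelSnd hG hi hF ha hb)).clm_apply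
      (contDiffAt_christoffelSnd hG hi hF hc hd))

theorem contDiffAt_sectional (hG : ContDiffAt ℝ ∞ G (F q)) (hi : (G (F q)).IsInvertible)
    (hF : ContDiffAt ℝ ∞ F q) {a b : P → E} (ha : ContDiffAt ℝ ∞ a q)
    (hb : ContDiffAt ℝ ∞ b q) :
    ContDiffAt ℝ ∞ (fun x ↦ sectional (curvatureForm G (F x)) (a x) (b x)) q :=
  ((contDiffAt_curvatureForm hG hi hF ha hb ha hb).sub
    (contDiffAt_const.mul (contDiffAt_curvatureForm hG hi hF hb hb ha ha))).sub
    (contDiffAt_const.mul (contDiffAt_curvatureForm hG hi hF ha ha hb hb))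

/-- A continuous square root of a smooth function is smooth where it does not vanish. -/
theorem contDiffAt_of_sq {s : P → ℝ} (hs : ContinuousAt s q) (h0 : s q ≠ 0)
    (h2 : ContDiffAt ℝ ∞ (fun x ↦ s x ^ 2) q) : ContDiffAt ℝ ∞ s q := by
  have hsq : ContDiffAt ℝ ∞ (fun x ↦ √(s x ^ 2)) q := h2.sqrt (by positivity)
  rcases lt_or_gt_of_ne h0 with h | h
  · refine hsq.neg.congr_of_eventuallyEq ?_
    filter_upwards [hs.eventually (gt_mem_nhds h)] with x hx
    rw [Real.sqrt_sq_eq_abs, abs_of_neg hx, neg_neg]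
  · refine hsq.congr_of_eventuallyEq ?_
    filter_upwards [hs.eventually (lt_mem_nhds h)] with x hx
    rw [Real.sqrt_sq_eq_abs, abs_of_pos hx]

end Smoothness

/-! ### Determinants in coordinates and curvature of the plane orthogonal to `n` -/

section Determinant

/-- The determinant of three vectors of `E3`. -/
def det3 (a b c : E3) : ℝ :=
  a 0 * (b 1 * c 2 - b 2 * c 1) - a 1 * (b 0 * c 2 - b 2 * c 0) + a 2 * (b 0 * c 1 - b 1 * c 0)

theorem contDiffAt_det3 {P : Type*} [NormedAddCommGroup P] [NormedSpace ℝ P] {a b c : P → E3}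
    {q : P} (ha : ContDiffAt ℝ ∞ a q) (hb : ContDiffAt ℝ ∞ b q) (hc : ContDiffAt ℝ ∞ c q) :
    ContDiffAt ℝ ∞ (fun x ↦ det3 (a x) (b x) (c x)) q := by
  rw [contDiffAt_euclidean] at ha hb hc
  unfold det3
  exact (((ha 0).mul (((hb 1).mul (hc 2)).sub ((hb 2).mul (hc 1)))).sub
    ((ha 1).mul (((hb 0).mul (hc 2)).sub ((hb 2).mul (hc 0))))).add
    ((ha 2).mul (((hb 0).mul (hc 1)).sub ((hb 1).mul (hc 0))))

/-- Cramer's rule. -/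
theorem det3_smul (x y n a : E3) :
    det3 x y n • a = det3 a y n • x + det3 x a n • y + det3 x y a • n := by
  ext i
  fin_cases i <;> simp [det3] <;> ring

/-- A Plücker relation: the left side is the determinant of the Cramer coefficients of `a` and `b`
with respect to `x` and `y`. -/
theorem det3_mul_sub (x y n a b : E3) :
    det3 a y n * det3 x b n - det3 x a n * det3 b y n = det3 x y n * det3 a b n := by
  simp only [det3]
  ring

theorem exists_det3_ne_zero {n : E3} (hn : n ≠ 0) : ∃ x y, det3 x y n ≠ 0 := by
  by_contra! h
  apply hn
  have h0 := h (EuclideanSpace.single 1 1) (EuclideanSpace.single 2 1)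
  have h1 := h (EuclideanSpace.single 2 1) (EuclideanSpace.single 0 1)
  have h2 := h (EuclideanSpace.single 0 1) (EuclideanSpace.single 1 1)
  simp [det3] at h0 h1 h2
  ext i
  fin_cases i <;> simp [h0, h1, h2]

/-- The biquadratic form `sectional B` on the plane orthogonal to a unit vector `n` is a
multiple of the square of the area. -/
theorem sectional_mul_det3_sq {B : E3 → E3 → E3 → E3 → ℝ} {g : E3 →L[ℝ] E3 →L[ℝ] ℝ}
    (h₁ : ∀ a b c d, B a b c d = B b a c d) (h₂ : ∀ a b c d, B a b c d = B a b d c)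
    (add₁ : ∀ a a' b c d, B (a + a') b c d = B a b c d + B a' b c d)
    (smul₁ : ∀ (r : ℝ) a b c d, B (r • a) b c d = r * B a b c d)
    (add₃ : ∀ a b c c' d, B a b (c + c') d = B a b c d + B a b c' d)
    (smul₃ : ∀ (r : ℝ) a b c d, B a b (r • c) d = r * B a b c d)
    {a b n : E3} (x y : E3) (hn : g n n = 1) (ha : g a n = 0) (hb : g b n = 0)
    (h0 : det3 x y n ≠ 0) :
    sectional B a b * det3 x y n ^ 2 =
      det3 a b n ^ 2 * sectional B (x - g x n • n) (y - g y n • n) := by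
  -- In Cramer's rule the coefficient of `n` is forced by `g a n = 0`, so `a` is a combination of
  -- the projections of `x` and `y` along `n`. This works even when `a` and `b` are dependent, as
  -- they are at singular points.
  have key : ∀ a, g a n = 0 → det3 x y n • a =
      det3 a y n • (x - g x n • n) + det3 x a n • (y - g y n • n) := by
    intro a ha
    have h := congrArg (fun z ↦ g z n) (det3_smul x y n a)
    simp only [map_add, map_smul, add_apply, smul_apply, smul_eq_mul, ha, hn] at h
    have h3 : det3 x y a = -(det3 a y n * g x n) - det3 x a n * g y n := by linarith
    rw [det3_smul, h3]
    module
  have h := sectional_smul_smul h₁ h₂ smul₁ smul₃ (det3 x y n) a b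
  rw [key a ha, key b hb, sectional_combination h₁ h₂ add₁ smul₁ add₃ smul₃, det3_mul_sub,
    mul_pow] at h
  apply mul_left_cancel₀ (pow_ne_zero 2 h0)
  linear_combination -h

end Determinant

/-! ### The Riemannian volume form in a chart -/

section Orientation

variable {M : Type*} [TopologicalSpace M] [ChartedSpace E3 M] [IsManifold 𝓘(ℝ, E3) ∞ M]
  [RiemannianBundle (fun x : M ↦ TangentSpace 𝓘(ℝ, E3) x)]

/-- The Riemannian volume of the coordinate frame of the chart at `x`. -/
def volCoeff (o : ∀ x : M, Orientation ℝ (TangentSpace 𝓘(ℝ, E3) x) (Fin 3)) (x y : M) : ℝ :=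
  (o y).volumeForm fun i ↦ frame x y (EuclideanSpace.single i 1)

/-- Alternating 3-forms on a 3-dimensional space form a line, so the pullback to `E3` is determined
by its value on the standard basis. -/
theorem volumeForm_frame (o : ∀ x : M, Orientation ℝ (TangentSpace 𝓘(ℝ, E3) x) (Fin 3)) (x y : M)
    (a b c : E3) : (o y).volumeForm ![frame x y a, frame x y b, frame x y c] =
      volCoeff o x y * det3 a b c := by
  have h := ((o y).volumeForm.compLinearMap (frame x y).toLinearMap).eq_smul_basis_det
    (EuclideanSpace.basisFun (Fin 3) ℝ).toBasis
  have h' := congrArg (fun φ ↦ φ ![a, b, c]) h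
  simp only [AlternatingMap.smul_apply, AlternatingMap.compLinearMap_apply, smul_eq_mul] at h'
  have e1 : (fun i ↦ (frame x y).toLinearMap (![a, b, c] i)) =
      ![frame x y a, frame x y b, frame x y c] := by
    ext i; fin_cases i <;> rfl
  have e2 : (EuclideanSpace.basisFun (Fin 3) ℝ).toBasis.det ![a, b, c] = det3 a b c := by
    rw [Module.Basis.det_apply, Matrix.det_fin_three]
    simp [Module.Basis.toMatrix_apply, det3]
    ring
  rw [e2] at h'
  rw [← e1]
  refine Eq.trans h' ?_
  simp [volCoeff]

variable {f : ℝ × ℝ → M} {q : ℝ × ℝ}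

theorem continuousAt_volCoeff {o : ∀ x : M, Orientation ℝ (TangentSpace 𝓘(ℝ, E3) x) (Fin 3)}
    (ho : IsManifoldOrientation o) (x : M) : ContinuousAt (volCoeff o x) x := by
  refine (ho x fun i ↦ EuclideanSpace.single i 1).congr ?_
  filter_upwards [(chartAt E3 x).open_source.mem_nhds (mem_chart_source E3 x)] with y hy
  rw [volCoeff]
  congr 1
  ext i : 1
  rw [frame, Bundle.Trivialization.symmL_apply]
  simpa using hy

theorem volCoeff_sq (o : ∀ x : M, Orientation ℝ (TangentSpace 𝓘(ℝ, E3) x) (Fin 3)) {x y : M}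
    (h : y ∈ (chartAt E3 x).source) :
    volCoeff o x y ^ 2 = Matrix.det (Matrix.of fun i j : Fin 3 ↦
      chartMetric x (extChartAt 𝓘(ℝ, E3) x y) (EuclideanSpace.single i 1)
        (EuclideanSpace.single j 1)) := by
  rw [sq, volCoeff, volumeForm_mul_volumeForm]
  simp only [chartMetric_apply x h]

theorem volCoeff_ne_zero (o : ∀ x : M, Orientation ℝ (TangentSpace 𝓘(ℝ, E3) x) (Fin 3)) {x y : M}
    (h : y ∈ (chartAt E3 x).source) : volCoeff o x y ≠ 0 := by
  intro h0
  have hv : (o y).volumeForm ≠ 0 := by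
    let b := (o y).finOrthonormalBasis (by norm_num) Fact.out
    have hb : b.toBasis.orientation = o y := (o y).finOrthonormalBasis_orientation _ _
    rw [(o y).volumeForm_robust b hb]
    exact b.toBasis.det_ne_zero
  apply hv
  ext v
  have : v = ![frame x y (coords x y (v 0)), frame x y (coords x y (v 1)),
      frame x y (coords x y (v 2))] := by
    simp only [frame_coords h]
    ext i : 1
    fin_cases i <;> rfl
  rw [this, volumeForm_frame, h0, zero_mul]
  rfl

/-- The orientation supplies only continuity, which fixes the sign. Smoothness comes from the
square, the Gram determinant of the chart metric. Continuity is known just at the centre of the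
chart, hence the chart at `f q`. -/
theorem contDiffAt_volCoeff
    [IsContMDiffRiemannianBundle 𝓘(ℝ, E3) ∞ E3 (fun x : M ↦ TangentSpace 𝓘(ℝ, E3) x)]
    {o : ∀ x : M, Orientation ℝ (TangentSpace 𝓘(ℝ, E3) x) (Fin 3)}
    (ho : IsManifoldOrientation o) (hf : ContMDiffAt 𝓘(ℝ, ℝ × ℝ) 𝓘(ℝ, E3) ∞ f q) :
    ContDiffAt ℝ ∞ (fun q' ↦ volCoeff o (f q) (f q')) q := by
  have hmem := mem_chart_source E3 (f q)
  refine contDiffAt_of_sq (ContinuousAt.comp (g := volCoeff o (f q)) (continuousAt_volCoeff ho _)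
    hf.continuousAt) (volCoeff_ne_zero o hmem) ?_
  have hg : ∀ i j : Fin 3, ContDiffAt ℝ ∞ (fun q' ↦ chartMetric (f q) (coordMap (f q) f q')
      (EuclideanSpace.single i 1) (EuclideanSpace.single j 1)) q := fun i j ↦
    ((ContDiffAt.comp (g := chartMetric (f q)) q (contDiffAt_chartMetric _ hmem)
      (contDiffAt_coordMap hmem hf)).clm_apply contDiffAt_const).clm_apply contDiffAt_const
  have hdet : ContDiffAt ℝ ∞ (fun q' ↦ Matrix.det (Matrix.of fun i j : Fin 3 ↦
      chartMetric (f q) (coordMap (f q) f q') (EuclideanSpace.single i 1)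
        (EuclideanSpace.single j 1))) q := by
    simp only [Matrix.det_fin_three, Matrix.of_apply]
    exact ((((((hg 0 0).mul (hg 1 1)).mul (hg 2 2)).sub (((hg 0 0).mul (hg 1 2)).mul (hg 2 1))).sub
      (((hg 0 1).mul (hg 1 0)).mul (hg 2 2))).add (((hg 0 1).mul (hg 1 2)).mul (hg 2 0))).add
      (((hg 0 2).mul (hg 1 0)).mul (hg 2 1)) |>.sub (((hg 0 2).mul (hg 1 1)).mul (hg 2 0))
  refine hdet.congr_of_eventuallyEq ?_
  filter_upwards [hf.continuousAt.eventually ((chartAt E3 (f q)).open_source.mem_nhds hmem)]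
    with q' hq'
  exact volCoeff_sq o hq'

end Orientation

/-! ### Metric compatibility and vanishing torsion along maps -/

theorem coordCov_congr {P E : Type*} [NormedAddCommGroup P] [NormedSpace ℝ P]
    [NormedAddCommGroup E] [NormedSpace ℝ E] {G : E → E →L[ℝ] E →L[ℝ] ℝ} {F A A' : P → E} {q : P}
    (h : A =ᶠ[𝓝 q] A') (w : P) : coordCov G F A w q = coordCov G F A' w q := by
  rw [coordCov, coordCov, h.fderiv_eq, h.self_of_nhds]

theorem coordCov_fderiv_comm {P E : Type*} [NormedAddCommGroup P] [NormedSpace ℝ P]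
    [NormedAddCommGroup E] [NormedSpace ℝ E] {G : E → E →L[ℝ] E →L[ℝ] ℝ} {F : P → E} {q : P}
    (hG : DifferentiableAt ℝ G (F q)) (hs : ∀ᶠ z in 𝓝 (F q), ∀ a b, G z a b = G z b a)
    (hF : ContDiffAt ℝ 2 F q) (a b : P) :
    coordCov G F (fun x ↦ fderiv ℝ F x a) b q = coordCov G F (fun x ↦ fderiv ℝ F x b) a q := by
  rw [coordCov, coordCov, fderiv_fderiv_comm hF a b, christoffelSnd_symm hG hs]

section LeviCivita

variable {M : Type*} [TopologicalSpace M] [ChartedSpace E3 M] [IsManifold 𝓘(ℝ, E3) ∞ M]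
  {x : M} {f : ℝ × ℝ → M} {q : ℝ × ℝ}

theorem differentiableAt_coordVec_vel (h : f q ∈ (chartAt E3 x).source)
    (hf : ContMDiffAt 𝓘(ℝ, ℝ × ℝ) 𝓘(ℝ, E3) ∞ f q) (w : ℝ × ℝ) :
    DifferentiableAt ℝ (coordVec x f (vel f w)) q :=
  ((contDiffAt_fderiv_apply (contDiffAt_coordMap h hf) w).differentiableAt
    (by simp)).congr_of_eventuallyEq (coordVec_vel_eventuallyEq h hf w)

variable [RiemannianBundle (fun x : M ↦ TangentSpace 𝓘(ℝ, E3) x)]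

theorem eventually_chartMetric_symm (x : M) (y : E3) :
    ∀ᶠ z in 𝓝 y, ∀ a b, chartMetric x z a b = chartMetric x z b a :=
  Filter.Eventually.of_forall fun z ↦ chartMetric_symm x z

theorem inner_eventuallyEq_chart {A B : ∀ q, TangentSpace 𝓘(ℝ, E3) (f q)}
    (h : f q ∈ (chartAt E3 x).source) (hf : ContinuousAt f q) :
    (fun q' ↦ ⟪A q', B q'⟫) =ᶠ[𝓝 q]
      fun q' ↦ chartMetric x (coordMap x f q') (coordVec x f A q') (coordVec x f B q') := by
  filter_upwards [hf.eventually ((chartAt E3 x).open_source.mem_nhds h)] with q' hq'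
  exact (chartMetric_coords x hq' _ _).symm

variable [IsContMDiffRiemannianBundle 𝓘(ℝ, E3) ∞ E3 (fun x : M ↦ TangentSpace 𝓘(ℝ, E3) x)]

theorem contDiffAt_chartMetric_coordMap (h : f q ∈ (chartAt E3 x).source) :
    ContDiffAt ℝ ∞ (chartMetric x) (coordMap x f q) :=
  contDiffAt_chartMetric x h

/-- The covariant derivative along a map is compatible with the metric. -/
theorem fderiv_inner_eq {A B : ∀ q, TangentSpace 𝓘(ℝ, E3) (f q)}
    (h : f q ∈ (chartAt E3 x).source) (hf : MDifferentiableAt 𝓘(ℝ, ℝ × ℝ) 𝓘(ℝ, E3) f q)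
    (hA : DifferentiableAt ℝ (coordVec x f A) q) (hB : DifferentiableAt ℝ (coordVec x f B) q)
    (w : ℝ × ℝ) :
    fderiv ℝ (fun q' ↦ ⟪A q', B q'⟫) q w = ⟪covDeriv f A w q, B q⟫ + ⟪A q, covDeriv f B w q⟫ := by
  have hF : DifferentiableAt ℝ (coordMap x f) q :=
    ((mdifferentiableAt_chart h).comp q hf).differentiableAt
  rw [(inner_eventuallyEq_chart h hf.continuousAt).fderiv_eq,
    fderiv_metric ((contDiffAt_chartMetric_coordMap h).differentiableAt (by simp))
      (eventually_chartMetric_symm _ _) hF hA hB,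
    real_inner_comm _ (A q), inner_covDeriv h hf hA, inner_covDeriv h hf hB]
  rfl

theorem covDeriv_vel_eq_frame (h : f q ∈ (chartAt E3 x).source)
    (hf : ContMDiffAt 𝓘(ℝ, ℝ × ℝ) 𝓘(ℝ, E3) ∞ f q) (a b : ℝ × ℝ) :
    covDeriv f (vel f a) b q = frame x (f q) (coordCov (chartMetric x) (coordMap x f)
      (fun q' ↦ fderiv ℝ (coordMap x f) q' a) b q) := by
  rw [covDeriv_eq_frame h (hf.mdifferentiableAt (by simp)) (differentiableAt_coordVec_vel h hf a),
    coordCov_congr (coordVec_vel_eventuallyEq h hf a)]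

/-- The Levi-Civita connection is torsion-free. -/
theorem covDeriv_vel_comm (hf : ContMDiffAt 𝓘(ℝ, ℝ × ℝ) 𝓘(ℝ, E3) ∞ f q) (a b : ℝ × ℝ) :
    covDeriv f (vel f a) b q = covDeriv f (vel f b) a q := by
  have hmem := mem_chart_source E3 (f q)
  rw [covDeriv_vel_eq_frame hmem hf, covDeriv_vel_eq_frame hmem hf, coordCov_fderiv_comm
    ((contDiffAt_chartMetric_coordMap hmem).differentiableAt (by simp))
    (eventually_chartMetric_symm _ _)
    ((contDiffAt_coordMap hmem hf).of_le ENat.LEInfty.out)]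

end LeviCivita

/-- A linear map from the plane is injective when its Gram determinant does not vanish. -/
theorem injective_iff_gram {V : Type*} [NormedAddCommGroup V] [InnerProductSpace ℝ V]
    (T : ℝ × ℝ →ₗ[ℝ] V) : Function.Injective T ↔
      ⟪T (1, 0), T (1, 0)⟫ * ⟪T (0, 1), T (0, 1)⟫ - ⟪T (1, 0), T (0, 1)⟫ ^ 2 ≠ 0 := by
  have hT : ∀ a b : ℝ, T (a, b) = a • T (1, 0) + b • T (0, 1) := fun a b ↦ by
    rw [← map_smul, ← map_smul, ← map_add]; simp
  set x := T (1, 0)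
  set y := T (0, 1)
  refine ⟨fun hinj h0 ↦ ?_, fun h0 ↦ ?_⟩
  · by_cases hy : ⟪y, y⟫ = 0
    · have h1 := hinj (a₁ := (0, 1)) (a₂ := 0) (by rw [map_zero]; exact inner_self_eq_zero.1 hy)
      simp at h1
    -- The image of this vector is `⟪y, y⟫` times the component of `x` orthogonal to `y`; its
    -- squared length is `⟪y, y⟫` times the Gram determinant.
    · have h1 : T (⟪y, y⟫, -⟪x, y⟫) = 0 := by
        rw [hT, ← inner_self_eq_zero (𝕜 := ℝ)]
        simp only [inner_add_left, inner_add_right, inner_smul_left, inner_smul_right,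
          real_inner_comm x y, RCLike.conj_to_real]
        linear_combination ⟪y, y⟫ * h0
      have h2 := hinj (h1.trans (map_zero T).symm)
      exact hy (congrArg Prod.fst h2)
  · refine (injective_iff_map_eq_zero T).2 ?_
    rintro ⟨a, b⟩ hab
    have hab' : a • x + b • y = 0 := (hT a b).symm.trans hab
    have h1 := congrArg (fun z ↦ ⟪z, x⟫) hab'
    have h2 := congrArg (fun z ↦ ⟪z, y⟫) hab'
    simp only [inner_add_left, inner_smul_left, RCLike.conj_to_real, inner_zero_left,
      real_inner_comm x y] at h1 h2
    ext
    · apply mul_right_cancel₀ h0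
      simp only [Prod.fst_zero]
      linear_combination ⟪y, y⟫ * h1 - ⟪x, y⟫ * h2
    · apply mul_right_cancel₀ h0
      simp only [Prod.snd_zero]
      linear_combination ⟪x, x⟫ * h2 - ⟪x, y⟫ * h1

/-! ### Frontals: the second fundamental form and the Gauss equation -/

section Frontal

variable {M : Type*} [TopologicalSpace M] [ChartedSpace E3 M] [IsManifold 𝓘(ℝ, E3) ∞ M]
  [RiemannianBundle (fun x : M ↦ TangentSpace 𝓘(ℝ, E3) x)]
  {x : M} {f : ℝ × ℝ → M} {ν : ∀ q, TangentSpace 𝓘(ℝ, E3) (f q)} {U : Set (ℝ × ℝ)} {q : ℝ × ℝ}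
  {o : ∀ x : M, Orientation ℝ (TangentSpace 𝓘(ℝ, E3) x) (Fin 3)}

theorem IsFrontal.contMDiffAt (hf : IsFrontal f ν U) (hU : IsOpen U) (hq : q ∈ U) :
    ContMDiffAt 𝓘(ℝ, ℝ × ℝ) 𝓘(ℝ, E3) ∞ f q :=
  hf.smooth.contMDiffAt (hU.mem_nhds hq)

theorem IsFrontal.contMDiffAt_normal (hf : IsFrontal f ν U) (hU : IsOpen U) (hq : q ∈ U) :
    ContMDiffAt 𝓘(ℝ, ℝ × ℝ) 𝓘(ℝ, E3).tangent ∞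
      (fun q ↦ (⟨f q, ν q⟩ : TangentBundle 𝓘(ℝ, E3) M)) q :=
  hf.smooth_normal.contMDiffAt (hU.mem_nhds hq)

theorem IsFrontal.inner_normal_self (hf : IsFrontal f ν U) (hq : q ∈ U) : ⟪ν q, ν q⟫ = 1 := by
  rw [real_inner_self_eq_norm_sq, hf.unit q hq, one_pow]

theorem IsFrontal.signedArea_sq (hf : IsFrontal f ν U) (hq : q ∈ U) :
    signedArea o f ν q ^ 2 =
      fstForm f (1, 0) (1, 0) q * fstForm f (0, 1) (0, 1) q - fstForm f (1, 0) (0, 1) q ^ 2 :=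
  volumeForm_sq_of_normal (o (f q)) (hf.inner_normal_self hq) (hf.normal q hq _) (hf.normal q hq _)

theorem IsFrontal.isSingularPoint_iff (hf : IsFrontal f ν U) (hq : q ∈ U) :
    IsSingularPoint f q ↔ signedArea o f ν q = 0 := by
  rw [← sq_eq_zero_iff, hf.signedArea_sq hq, IsSingularPoint, not_iff_comm]
  exact (injective_iff_gram (mfderiv 𝓘(ℝ, ℝ × ℝ) 𝓘(ℝ, E3) f q).toLinearMap).symm

theorem fstForm_eventuallyEq (h : f q ∈ (chartAt E3 x).source)
    (hf : ContMDiffAt 𝓘(ℝ, ℝ × ℝ) 𝓘(ℝ, E3) ∞ f q) (a b : ℝ × ℝ) :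
    fstForm f a b =ᶠ[𝓝 q] fun q' ↦ chartMetric x (coordMap x f q')
      (fderiv ℝ (coordMap x f) q' a) (fderiv ℝ (coordMap x f) q' b) := by
  filter_upwards [inner_eventuallyEq_chart (A := vel f a) (B := vel f b) h hf.continuousAt,
    coordVec_vel_eventuallyEq h hf a, coordVec_vel_eventuallyEq h hf b] with q' h1 h2 h3
  rw [← h2, ← h3]
  exact h1

variable [IsContMDiffRiemannianBundle 𝓘(ℝ, E3) ∞ E3 (fun x : M ↦ TangentSpace 𝓘(ℝ, E3) x)]

theorem IsFrontal.inner_covDeriv_normal (hf : IsFrontal f ν U) (hU : IsOpen U) (hq : q ∈ U)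
    (w : ℝ × ℝ) : ⟪covDeriv f ν w q, ν q⟫ = 0 := by
  have hd := (contDiffAt_coordVec (mem_chart_source E3 (f q))
    (hf.contMDiffAt_normal hU hq)).differentiableAt (by simp)
  have h := fderiv_inner_eq (mem_chart_source E3 (f q))
    ((hf.contMDiffAt hU hq).mdifferentiableAt (by simp)) hd hd w
  have h1 : (fun q ↦ ⟪ν q, ν q⟫) =ᶠ[𝓝 q] fun _ ↦ (1 : ℝ) := by
    filter_upwards [hU.mem_nhds hq] with q' hq' using hf.inner_normal_self hq'
  rw [h1.fderiv_eq, real_inner_comm (covDeriv f ν w q) (ν q)] at h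
  simp at h
  linarith

/-- Differentiate `⟪f_a, ν⟫ = 0`, which holds on a neighbourhood because `U` is open. -/
theorem IsFrontal.inner_covDeriv_vel (hf : IsFrontal f ν U) (hU : IsOpen U) (hq : q ∈ U)
    (a b : ℝ × ℝ) : ⟪covDeriv f (vel f a) b q, ν q⟫ = -⟪vel f a q, covDeriv f ν b q⟫ := by
  have hmem := mem_chart_source E3 (f q)
  have hd := (contDiffAt_coordVec hmem (hf.contMDiffAt_normal hU hq)).differentiableAt (by simp)
  have h := fderiv_inner_eq hmem ((hf.contMDiffAt hU hq).mdifferentiableAt (by simp))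
    (differentiableAt_coordVec_vel hmem (hf.contMDiffAt hU hq) a) hd b
  have h1 : (fun q ↦ ⟪vel f a q, ν q⟫) =ᶠ[𝓝 q] fun _ ↦ (0 : ℝ) := by
    filter_upwards [hU.mem_nhds hq] with q' hq' using hf.normal q' hq' a
  rw [h1.fderiv_eq] at h
  simp at h
  linarith

theorem pd_fstForm (hf : ContMDiffAt 𝓘(ℝ, ℝ × ℝ) 𝓘(ℝ, E3) ∞ f q) (a b w : ℝ × ℝ) :
    pd w (fstForm f a b) q =
      ⟪covDeriv f (vel f a) w q, vel f b q⟫ + ⟪covDeriv f (vel f b) w q, vel f a q⟫ := by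
  have hmem := mem_chart_source E3 (f q)
  rw [real_inner_comm (vel f a q)]
  exact fderiv_inner_eq hmem (hf.mdifferentiableAt (by simp))
    (differentiableAt_coordVec_vel hmem hf a) (differentiableAt_coordVec_vel hmem hf b) w

/-- The left side is the corner entry of Brioschi's first matrix. It is the only place where second
derivatives of the metric, and hence the ambient curvature, enter. -/
theorem pd_pd_fstForm (h : f q ∈ (chartAt E3 x).source)
    (hf : ContMDiffAt 𝓘(ℝ, ℝ × ℝ) 𝓘(ℝ, E3) ∞ f q) (u v : ℝ × ℝ) :
    -(1 / 2) * pd v (pd v (fstForm f u u)) q + pd u (pd v (fstForm f u v)) q -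
        (1 / 2) * pd u (pd u (fstForm f v v)) q =
      ⟪covDeriv f (vel f u) u q, covDeriv f (vel f v) v q⟫ -
        ⟪covDeriv f (vel f u) v q, covDeriv f (vel f u) v q⟫ +
        sectional (curvatureForm (chartMetric x) (coordMap x f q))
          (fderiv ℝ (coordMap x f) q u) (fderiv ℝ (coordMap x f) q v) := by
  have key : ∀ a b w z : ℝ × ℝ, pd z (pd w (fstForm f a b)) q = fderiv ℝ (fun x' ↦ fderiv ℝ
      (fun q' ↦ chartMetric x (coordMap x f q') (fderiv ℝ (coordMap x f) q' a)
        (fderiv ℝ (coordMap x f) q' b)) x' w) q z := by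
    intro a b w z
    have e := (fstForm_eventuallyEq h hf a b).fderiv (𝕜 := ℝ)
    have e' : pd w (fstForm f a b) =ᶠ[𝓝 q] fun x' ↦ fderiv ℝ
      (fun q' ↦ chartMetric x (coordMap x f q') (fderiv ℝ (coordMap x f) q' a)
        (fderiv ℝ (coordMap x f) q' b)) x' w := e.mono fun q' h' ↦ by rw [pd, h']
    rw [pd, e'.fderiv_eq]
  have g := gauss_equation (G := chartMetric x) (F := coordMap x f) (q := q)
    (contDiffAt_chartMetric_coordMap h) (contDiffAt_coordMap h hf)
    (eventually_chartMetric_symm _ _) (isInvertible_chartMetric x h) u v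
  rw [key, key, key]
  refine g.trans ?_
  rw [covDeriv_vel_eq_frame h hf, covDeriv_vel_eq_frame h hf, covDeriv_vel_eq_frame h hf]
  congr 1
  rw [← chartMetric_apply x h, ← chartMetric_apply x h]
  rfl

/-- The Gauss equation: the intrinsic curvature is the sum of the extrinsic curvature and the
sectional curvature of the ambient manifold. -/
theorem IsFrontal.gaussCurvature_mul_signedArea (hf : IsFrontal f ν U) (hU : IsOpen U)
    (hq : q ∈ U) (h : f q ∈ (chartAt E3 x).source) (h0 : signedArea o f ν q ≠ 0) :
    gaussCurvature f q * signedArea o f ν q =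
      (o (f q)).volumeForm ![covDeriv f ν (1, 0) q, covDeriv f ν (0, 1) q, ν q] +
        sectional (curvatureForm (chartMetric x) (coordMap x f q))
          (fderiv ℝ (coordMap x f) q (1, 0)) (fderiv ℝ (coordMap x f) q (0, 1)) /
          signedArea o f ν q := by
  have hs := hf.contMDiffAt hU hq
  have key := brioschi_div_mul_volumeForm (o (f q))
    (ρ := sectional (curvatureForm (chartMetric x) (coordMap x f q))
      (fderiv ℝ (coordMap x f) q (1, 0)) (fderiv ℝ (coordMap x f) q (0, 1)))
    (hf.inner_normal_self hq) (hf.normal q hq (1, 0)) (hf.normal q hq (0, 1)) h0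
    (hf.inner_covDeriv_normal hU hq (1, 0)) (hf.inner_covDeriv_normal hU hq (0, 1))
    (hf.inner_covDeriv_vel hU hq (1, 0) (1, 0)) (hf.inner_covDeriv_vel hU hq (1, 0) (0, 1))
    -- The mixed coefficient must also be read as `-⟪f_v, ∇_u ν⟫`, which requires `∇_v f_u = ∇_u
    -- f_v`.
    ((congrArg (fun z ↦ ⟪z, ν q⟫) (covDeriv_vel_comm hs (1, 0) (0, 1))).trans
      (hf.inner_covDeriv_vel hU hq (0, 1) (1, 0)))
    (hf.inner_covDeriv_vel hU hq (0, 1) (0, 1))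
  rw [← pd_pd_fstForm h hs] at key
  refine Eq.trans ?_ key
  rw [gaussCurvature]
  simp only [pd_fstForm hs, covDeriv_vel_comm hs (0, 1) (1, 0)]
  congr 2
  congr 1
  · congr 1
    ext i j
    fin_cases i <;> fin_cases j <;> simp [fstForm] <;> ring
  · congr 1
    ext i j
    fin_cases i <;> fin_cases j <;> simp [fstForm] <;> ring

end Frontal

/-! ### Smooth extension of `K dÂ` across the singular set -/

section Extension

variable {M : Type*} [TopologicalSpace M] [ChartedSpace E3 M] [IsManifold 𝓘(ℝ, E3) ∞ M]
  [RiemannianBundle (fun x : M ↦ TangentSpace 𝓘(ℝ, E3) x)]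
  {x : M} {f : ℝ × ℝ → M} {ν : ∀ q, TangentSpace 𝓘(ℝ, E3) (f q)} {U : Set (ℝ × ℝ)} {q : ℝ × ℝ}
  {o : ∀ x : M, Orientation ℝ (TangentSpace 𝓘(ℝ, E3) x) (Fin 3)}

theorem signedArea_eq_det3 (h : f q ∈ (chartAt E3 x).source)
    (hf : ContMDiffAt 𝓘(ℝ, ℝ × ℝ) 𝓘(ℝ, E3) ∞ f q) :
    signedArea o f ν q = volCoeff o x (f q) * det3 (fderiv ℝ (coordMap x f) q (1, 0))
      (fderiv ℝ (coordMap x f) q (0, 1)) (coordVec x f ν q) := by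
  have hd := hf.mdifferentiableAt (by simp)
  rw [← volumeForm_frame, ← coords_vel h hd, ← coords_vel h hd, coordVec, frame_coords h,
    frame_coords h, frame_coords h, signedArea]

variable [IsContMDiffRiemannianBundle 𝓘(ℝ, E3) ∞ E3 (fun x : M ↦ TangentSpace 𝓘(ℝ, E3) x)]

theorem IsFrontal.volumeForm_covDeriv_eq_det3 (hf : IsFrontal f ν U) (hU : IsOpen U) (hq : q ∈ U)
    (h : f q ∈ (chartAt E3 x).source) :
    (o (f q)).volumeForm ![covDeriv f ν (1, 0) q, covDeriv f ν (0, 1) q, ν q] =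
      volCoeff o x (f q) * det3 (coordCov (chartMetric x) (coordMap x f) (coordVec x f ν) (1, 0) q)
        (coordCov (chartMetric x) (coordMap x f) (coordVec x f ν) (0, 1) q)
        (coordVec x f ν q) := by
  have hd := (hf.contMDiffAt hU hq).mdifferentiableAt (by simp)
  have hV := (contDiffAt_coordVec h (hf.contMDiffAt_normal hU hq)).differentiableAt (by simp)
  rw [← volumeForm_frame, ← covDeriv_eq_frame h hd hV, ← covDeriv_eq_frame h hd hV, coordVec,
    frame_coords h]

/-- The sectional curvature of `M` in the plane orthogonal to `ν`, computed in the chart at `x`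
from auxiliary vectors `a` and `b`, up to the factor which normalizes these vectors. -/
def normalSectional (x : M) (f : ℝ × ℝ → M) (ν : ∀ q, TangentSpace 𝓘(ℝ, E3) (f q)) (a b : E3)
    (q : ℝ × ℝ) : ℝ :=
  sectional (curvatureForm (chartMetric x) (coordMap x f q))
    (a - chartMetric x (coordMap x f q) a (coordVec x f ν q) • coordVec x f ν q)
    (b - chartMetric x (coordMap x f q) b (coordVec x f ν q) • coordVec x f ν q)

/-- A formula for the form `K dÂ` in a chart, which is valid at all points. -/
theorem IsFrontal.KdA_eq (hf : IsFrontal f ν U) (hU : IsOpen U) (hq : q ∈ U)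
    (h : f q ∈ (chartAt E3 x).source) {a b : E3} (h0 : det3 a b (coordVec x f ν q) ≠ 0) :
    KdA o f ν q =
      volCoeff o x (f q) * det3 (coordCov (chartMetric x) (coordMap x f) (coordVec x f ν) (1, 0) q)
        (coordCov (chartMetric x) (coordMap x f) (coordVec x f ν) (0, 1) q) (coordVec x f ν q) +
      volCoeff o x (f q) * det3 (fderiv ℝ (coordMap x f) q (1, 0))
        (fderiv ℝ (coordMap x f) q (0, 1)) (coordVec x f ν q) *
      (normalSectional x f ν a b q / (volCoeff o x (f q) * det3 a b (coordVec x f ν q)) ^ 2) := by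
  have hs := hf.contMDiffAt hU hq
  have hd := hs.mdifferentiableAt (by simp)
  rw [← hf.volumeForm_covDeriv_eq_det3 hU hq h, ← signedArea_eq_det3 h hs, KdA]
  split_ifs with hsing
  -- At a singular point `λ = 0` removes the ambient curvature term, leaving the prescribed value.
  · rw [(hf.isSingularPoint_iff hq).1 hsing, zero_mul, add_zero]
  · have hl : signedArea o f ν q ≠ 0 := fun h0 ↦ hsing ((hf.isSingularPoint_iff hq).2 h0)
    rw [hf.gaussCurvature_mul_signedArea hU hq h hl]
    congr 1
    have hG := (contDiffAt_chartMetric_coordMap h).of_le (m := 2) ENat.LEInfty.out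
    have hsy := eventually_chartMetric_symm x (coordMap x f q)
    have hN : chartMetric x (coordMap x f q) (coordVec x f ν q) (coordVec x f ν q) = 1 :=
      (chartMetric_coords x h _ _).trans (hf.inner_normal_self hq)
    have hT : ∀ w, chartMetric x (coordMap x f q) (fderiv ℝ (coordMap x f) q w)
        (coordVec x f ν q) = 0 := fun w ↦ by
      rw [← coords_vel h hd]
      exact (chartMetric_coords x h _ _).trans (hf.normal q hq w)
    -- This is `ρ = λ² c` up to the volume factor, which turns the singular-looking `ρ / λ` into `λ
    -- c`.
    have key := sectional_mul_det3_sq (curvatureForm_symm_left hG hsy)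
      (curvatureForm_symm_right hG hsy) (curvatureForm_add_left _ _) (curvatureForm_smul_left _ _)
      (curvatureForm_add_third _ _) (curvatureForm_smul_third _ _) a b hN (hT (1, 0)) (hT (0, 1)) h0
    have hv := volCoeff_ne_zero o h
    rw [normalSectional, div_eq_iff hl]
    have hl' := signedArea_eq_det3 (o := o) (ν := ν) h hs
    field_simp
    rw [hl']
    linear_combination volCoeff o x (f q) ^ 2 * key

/-- The formula of `IsFrontal.KdA_eq` has no case distinction. Its only denominator is the volume
spanned by two constant vectors and `ν`, nonzero near `q` once the vectors are chosen at `q`. -/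
theorem IsFrontal.contDiffOn_KdA (ho : IsManifoldOrientation o) (hf : IsFrontal f ν U)
    (hU : IsOpen U) : ContDiffOn ℝ ∞ (KdA o f ν) U := by
  intro q hq
  refine ContDiffAt.contDiffWithinAt ?_
  have hmem := mem_chart_source E3 (f q)
  have hs := hf.contMDiffAt hU hq
  have hF := contDiffAt_coordMap hmem hs
  have hN := contDiffAt_coordVec hmem (hf.contMDiffAt_normal hU hq)
  have hG := contDiffAt_chartMetric_coordMap hmem
  have hi := isInvertible_chartMetric (f q) hmem
  have hν0 : coordVec (f q) f ν q ≠ 0 := by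
    intro h0
    have h1 := (chartMetric_coords (f q) hmem (ν q) (ν q)).trans (hf.inner_normal_self hq)
    rw [show coords (f q) (f q) (ν q) = 0 from h0, map_zero] at h1
    simp at h1
  obtain ⟨a, b, hab⟩ := exists_det3_ne_zero hν0
  have hdet : ContDiffAt ℝ ∞ (fun q' ↦ det3 a b (coordVec (f q) f ν q')) q :=
    contDiffAt_det3 contDiffAt_const contDiffAt_const hN
  have hvol := contDiffAt_volCoeff ho hs
  have hGF : ContDiffAt ℝ ∞ (fun q' ↦ chartMetric (f q) (coordMap (f q) f q')) q := hG.comp q hF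
  have hproj : ∀ a : E3, ContDiffAt ℝ ∞ (fun q' ↦ a - chartMetric (f q) (coordMap (f q) f q') a
      (coordVec (f q) f ν q') • coordVec (f q) f ν q') q := fun a ↦
    contDiffAt_const.sub (((hGF.clm_apply contDiffAt_const).clm_apply hN).smul hN)
  have hsec : ContDiffAt ℝ ∞ (normalSectional (f q) f ν a b) q :=
    contDiffAt_sectional hG hi hF (hproj a) (hproj b)
  have hcov := fun w ↦ contDiffAt_coordCov hG hi hF hN w
  have H := (hvol.mul (contDiffAt_det3 (hcov (1, 0)) (hcov (0, 1)) hN)).add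
    ((hvol.mul (contDiffAt_det3 (contDiffAt_fderiv_apply hF (1, 0))
      (contDiffAt_fderiv_apply hF (0, 1)) hN)).mul (hsec.div ((hvol.mul hdet).pow 2)
      (pow_ne_zero 2 (mul_ne_zero (volCoeff_ne_zero o hmem) hab))))
  refine H.congr_of_eventuallyEq ?_
  filter_upwards [hU.mem_nhds hq, hdet.continuousAt.eventually_ne hab,
    hs.continuousAt.eventually ((chartAt E3 (f q)).open_source.mem_nhds hmem)] with q' h1 h2 h3
  exact hf.KdA_eq hU h1 h3 h2

end Extension

theorem exists_smul_add_smul {a b : ℝ × ℝ} (hab : a.1 * b.2 - a.2 * b.1 ≠ 0) (w : ℝ × ℝ) :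
    ∃ r s : ℝ, w = r • a + s • b := by
  refine ⟨(a.1 * b.2 - a.2 * b.1)⁻¹ * (w.1 * b.2 - w.2 * b.1),
    (a.1 * b.2 - a.2 * b.1)⁻¹ * (a.1 * w.2 - a.2 * w.1), ?_⟩
  have := inv_mul_cancel₀ hab
  ext
  · simp only [Prod.fst_add, Prod.smul_fst, smul_eq_mul]
    linear_combination -w.1 * this
  · simp only [Prod.snd_add, Prod.smul_snd, smul_eq_mul]
    linear_combination -w.2 * this

/-! ### Degeneracy of the shape operator at singular points -/

section Curvature

variable {M : Type*} [TopologicalSpace M] [ChartedSpace E3 M] [IsManifold 𝓘(ℝ, E3) ∞ M]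
  {f : ℝ × ℝ → M} {ν : ∀ q, TangentSpace 𝓘(ℝ, E3) (f q)} {U : Set (ℝ × ℝ)} {q : ℝ × ℝ}

/-- The kernel of the derivative of a vector field along a map, viewed as a map into the tangent
bundle. -/
theorem mfderiv_vectorField_eq_zero {x : M} (h : f q ∈ (chartAt E3 x).source)
    (hν : ContMDiffAt 𝓘(ℝ, ℝ × ℝ) 𝓘(ℝ, E3).tangent ∞
      (fun q ↦ (⟨f q, ν q⟩ : TangentBundle 𝓘(ℝ, E3) M)) q) {w : ℝ × ℝ} (hw : vel f w q = 0)
    (hw' : fderiv ℝ (coordVec x f ν) q w = 0) :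
    mfderiv 𝓘(ℝ, ℝ × ℝ) 𝓘(ℝ, E3).tangent
      (fun q' ↦ (⟨f q', ν q'⟩ : TangentBundle 𝓘(ℝ, E3) M)) q w = 0 := by
  let e := trivializationAt E3 (TangentSpace 𝓘(ℝ, E3) (M := M)) x
  have hmem : (⟨f q, ν q⟩ : TangentBundle 𝓘(ℝ, E3) M) ∈ e.source := by
    rw [Bundle.Trivialization.mem_source]; simpa [e] using h
  have hf : ContMDiffAt 𝓘(ℝ, ℝ × ℝ) 𝓘(ℝ, E3) ∞ f q := (Bundle.Trivialization.contMDiffAt_iff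
    (f := fun q ↦ (⟨f q, ν q⟩ : TangentBundle 𝓘(ℝ, E3) M)) hmem).1 hν |>.1
  have hfd := hf.mdifferentiableAt (by simp)
  have hN : MDifferentiableAt 𝓘(ℝ, ℝ × ℝ) 𝓘(ℝ, E3) (coordVec x f ν) q :=
    ((contDiffAt_coordVec h hν).differentiableAt (by simp)).mdifferentiableAt
  have hsrc : ∀ᶠ q' in 𝓝 q, f q' ∈ (chartAt E3 x).source :=
    hf.continuousAt.eventually ((chartAt E3 x).open_source.mem_nhds h)
  have heq : (fun q' ↦ (⟨f q', ν q'⟩ : TangentBundle 𝓘(ℝ, E3) M)) =ᶠ[𝓝 q]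
      e.toOpenPartialHomeomorph.symm ∘ fun q' ↦ (f q', coordVec x f ν q') := by
    filter_upwards [hsrc] with q' hq'
    have hb : f q' ∈ e.baseSet := by simpa [e] using hq'
    rw [Function.comp_apply, coordVec, ← Bundle.Trivialization.mk_symm e hb,
      ← Bundle.Trivialization.symmL_apply (R := ℝ) e hb]
    exact congrArg _ (frame_coords hq' (ν q')).symm
  have he : MDifferentiableAt (𝓘(ℝ, E3).prod 𝓘(ℝ, E3)) 𝓘(ℝ, E3).tangent
      e.toOpenPartialHomeomorph.symm (f q, coordVec x f ν q) := by
    have := Bundle.Trivialization.contMDiffOn_symm (n := ∞) (IB := 𝓘(ℝ, E3)) e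
    refine (this.contMDiffAt (e.open_target.mem_nhds ?_)).mdifferentiableAt (by simp)
    rw [Bundle.Trivialization.mem_target]
    simpa [e] using h
  have h0 : mfderiv 𝓘(ℝ, ℝ × ℝ) (𝓘(ℝ, E3).prod 𝓘(ℝ, E3))
      (fun q' ↦ (f q', coordVec x f ν q')) q w = 0 := by
    rw [mfderiv_prodMk hfd hN, mfderiv_eq_fderiv]
    exact Prod.ext hw hw'
  rw [heq.mfderiv_eq]
  refine (mfderiv_comp_apply q he (hfd.prodMk hN) w).trans ?_
  rw [h0, map_zero]
  rfl

variable [RiemannianBundle (fun x : M ↦ TangentSpace 𝓘(ℝ, E3) x)]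

theorem christoffel_add_left (x : M) (a a' b : TangentSpace 𝓘(ℝ, E3) x) :
    christoffel x (a + a') b = christoffel x a b + christoffel x a' b := by
  refine ext_inner_right (E := TangentSpace 𝓘(ℝ, E3) x) ℝ fun c ↦ ?_
  rw [inner_add_left, inner_christoffel, inner_christoffel, inner_christoffel]
  exact congrArg (fun φ ↦ φ c) (christoffelFst_add_left (E := E3) (chartMetric x) _ a a' b)

theorem christoffel_smul_left (x : M) (r : ℝ) (a b : TangentSpace 𝓘(ℝ, E3) x) :
    christoffel x (r • a) b = r • christoffel x a b := by
  refine ext_inner_right (E := TangentSpace 𝓘(ℝ, E3) x) ℝ fun c ↦ ?_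
  rw [real_inner_smul_left, inner_christoffel, inner_christoffel]
  exact congrArg (fun φ ↦ φ c) (christoffelFst_smul_left (E := E3) (chartMetric x) _ r a b)

/-- The covariant derivative of a vector field, as a linear map. -/
def covDerivₗ (f : ℝ × ℝ → M) (V : ∀ q, TangentSpace 𝓘(ℝ, E3) (f q)) (q : ℝ × ℝ) :
    ℝ × ℝ →ₗ[ℝ] TangentSpace 𝓘(ℝ, E3) (f q) where
  toFun w := covDeriv f V w q
  map_add' a b := by
    have h1 : vel f (a + b) q = vel f a q + vel f b q := map_add _ a b
    simp only [covDeriv, h1, map_add, christoffel_add_left]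
    exact add_add_add_comm (G := TangentSpace 𝓘(ℝ, E3) (f q)) _ _ _ _
  map_smul' r a := by
    have h1 : vel f (r • a) q = r • vel f a q := map_smul _ r a
    simp only [covDeriv, h1, map_smul, christoffel_smul_left]
    exact (smul_add (A := TangentSpace 𝓘(ℝ, E3) (f q)) r _ _).symm

theorem covDerivₗ_apply (f : ℝ × ℝ → M) (V : ∀ q, TangentSpace 𝓘(ℝ, E3) (f q)) (q w : ℝ × ℝ) :
    covDerivₗ f V q w = covDeriv f V w q := rfl

variable {o : ∀ x : M, Orientation ℝ (TangentSpace 𝓘(ℝ, E3) x) (Fin 3)}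
  [IsContMDiffRiemannianBundle 𝓘(ℝ, E3) ∞ E3 (fun x : M ↦ TangentSpace 𝓘(ℝ, E3) x)]

/-- Here the front condition enters. When `df(w) = 0` the Christoffel term vanishes, so `∇_w ν` is
the plain derivative of the coordinates of `ν`; were it zero too, `w` would be in the kernel of the
derivative of `ν : U → TM`. -/
theorem IsFront.covDeriv_ne_zero (hf : IsFront f ν U) (hU : IsOpen U) (hq : q ∈ U) {w : ℝ × ℝ}
    (hw : w ≠ 0) (h : vel f w q = 0) : covDeriv f ν w q ≠ 0 := by
  intro h0
  have hmem := mem_chart_source E3 (f q)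
  have hd := (hf.contMDiffAt hU hq).mdifferentiableAt (by simp)
  have hV := contDiffAt_coordVec hmem (hf.contMDiffAt_normal hU hq)
  have hΓ : christoffelSnd (chartMetric (f q)) (coordMap (f q) f q) 0 (coordVec (f q) f ν q) = 0 := by
    simpa using christoffelSnd_smul_left (chartMetric (f q)) (coordMap (f q) f q) 0 0
      (coordVec (f q) f ν q)
  rw [covDeriv_eq_frame hmem hd (hV.differentiableAt (by simp)), coordCov, ← coords_vel hmem hd,
    h, map_zero, hΓ, add_zero] at h0
  have h1 := congrArg (coords (f q) (f q)) h0
  rw [coords_frame hmem, map_zero] at h1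
  exact hw (hf.immersion q hq ((mfderiv_vectorField_eq_zero hmem (hf.contMDiffAt_normal hU hq)
    h h1).trans (map_zero _).symm))

/-- At a singular point, the form `K dÂ` vanishes when the shape operator is degenerate. -/
theorem IsFrontal.KdA_eq_zero_iff (hf : IsFrontal f ν U) (hU : IsOpen U) (hq : q ∈ U)
    (hs : IsSingularPoint f q) :
    KdA o f ν q = 0 ↔ ¬ Function.Injective (covDerivₗ f ν q) := by
  rw [KdA, if_pos hs, injective_iff_gram, not_not, ← sq_eq_zero_iff,
    volumeForm_sq_of_normal (o (f q)) (hf.inner_normal_self hq)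
      (hf.inner_covDeriv_normal hU hq _) (hf.inner_covDeriv_normal hU hq _)]
  rfl

theorem IsFrontal.inner_vel_covDeriv_comm (hf : IsFrontal f ν U) (hU : IsOpen U) (hq : q ∈ U)
    (a b : ℝ × ℝ) : ⟪vel f a q, covDeriv f ν b q⟫ = ⟪vel f b q, covDeriv f ν a q⟫ := by
  rw [← neg_inj, ← hf.inner_covDeriv_vel hU hq, ← hf.inner_covDeriv_vel hU hq,
    covDeriv_vel_comm (hf.contMDiffAt hU hq)]

/-- The degeneracy of the shape operator at a point where `df(b) = 0`, in terms of the second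
fundamental form. -/
theorem IsFront.inner_vel_covDeriv_eq_zero_iff (hf : IsFront f ν U) (hU : IsOpen U) (hq : q ∈ U)
    (o : ∀ x : M, Orientation ℝ (TangentSpace 𝓘(ℝ, E3) x) (Fin 3))
    {a b : ℝ × ℝ} (hb : vel f b q = 0) (hab : a.1 * b.2 - a.2 * b.1 ≠ 0) (ha : vel f a q ≠ 0) :
    ⟪vel f a q, covDeriv f ν a q⟫ = 0 ↔ ¬ Function.Injective (covDerivₗ f ν q) := by
  have hb0 : b ≠ 0 := by rintro rfl; simp at hab
  have hbν := hf.covDeriv_ne_zero hU hq hb0 hb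
  have hspan := exists_smul_add_smul hab
  have hab0 : ⟪vel f a q, covDeriv f ν b q⟫ = 0 := by
    rw [hf.inner_vel_covDeriv_comm hU hq, hb, inner_zero_left]
  have hlin : ∀ r s : ℝ, ⟪vel f a q, covDeriv f ν (r • a + s • b) q⟫ =
      r * ⟪vel f a q, covDeriv f ν a q⟫ := fun r s ↦ by
    rw [← covDerivₗ_apply, map_add, map_smul, map_smul, covDerivₗ_apply, covDerivₗ_apply,
      inner_add_right, real_inner_smul_right, real_inner_smul_right, hab0, mul_zero, add_zero]
  constructor
  · intro h
    have hall : ∀ w, ⟪covDeriv f ν w q, vel f a q⟫ = 0 := fun w ↦ by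
      obtain ⟨r, s, rfl⟩ := hspan w
      rw [real_inner_comm, hlin, h, mul_zero]
    -- Compare with the orthogonal frame `f_a`, `∇_b ν`, `ν`. Its volume is nonzero, while the Gram
    -- matrix has a zero column, since `∇_u ν`, `∇_v ν` and `ν` are all orthogonal to `f_a`.
    have h1 := volumeForm_mul_volumeForm_fin_three (o (f q)) (covDeriv f ν (1, 0) q)
      (covDeriv f ν (0, 1) q) (ν q) (vel f a q) (covDeriv f ν b q) (ν q)
    have h2 := volumeForm_sq_of_normal (o (f q)) (hf.inner_normal_self hq) (hf.normal q hq a)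
      (hf.inner_covDeriv_normal hU hq b)
    rw [hall, hall, real_inner_comm (vel f a q) (ν q), hf.normal q hq] at h1
    rw [hab0] at h2
    have h3 : (o (f q)).volumeForm ![vel f a q, covDeriv f ν b q, ν q] ≠ 0 := by
      rw [← pow_ne_zero_iff two_ne_zero, h2]
      simpa using ⟨ha, hbν⟩
    have h4 : (o (f q)).volumeForm ![covDeriv f ν (1, 0) q, covDeriv f ν (0, 1) q, ν q] = 0 := by
      apply mul_right_cancel₀ h3
      rw [h1]
      ring
    rw [injective_iff_gram, not_not]
    have h5 := volumeForm_sq_of_normal (o (f q)) (hf.inner_normal_self hq)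
      (hf.inner_covDeriv_normal hU hq (1, 0)) (hf.inner_covDeriv_normal hU hq (0, 1))
    rw [h4] at h5
    simp only [covDerivₗ_apply]
    rw [← h5]
    norm_num
  · intro h
    rw [injective_iff_map_eq_zero] at h
    push Not at h
    obtain ⟨w, hw, hw0⟩ := h
    obtain ⟨r, s, rfl⟩ := hspan w
    rw [covDerivₗ_apply] at hw
    have h1 := hlin r s
    rw [hw, inner_zero_right] at h1
    -- A kernel vector `r a + s b` with `r = 0` would be a nonzero multiple of `b`, contradicting
    -- `∇_b ν ≠ 0`.
    rcases mul_eq_zero.1 h1.symm with hr | hr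
    · exfalso
      subst hr
      rw [zero_smul, zero_add] at hw hw0
      have hs : s ≠ 0 := by rintro rfl; simp at hw0
      rw [← covDerivₗ_apply, map_smul, smul_eq_zero] at hw
      exact hw.elim hs hbν
    · exact hr

end Curvature

/-! ### Admissible coordinates and the limiting normal curvature -/

section NormalCurvature

variable {M : Type*} [TopologicalSpace M] [ChartedSpace E3 M]
  {f : ℝ × ℝ → M} {ν : ∀ q, TangentSpace 𝓘(ℝ, E3) (f q)} {U : Set (ℝ × ℝ)} {p : ℝ × ℝ}
  {φ : OpenPartialHomeomorph (ℝ × ℝ) (ℝ × ℝ)}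

theorem IsRankOneSingularPoint.isSingularPoint (h : IsRankOneSingularPoint f p) :
    IsSingularPoint f p := by
  intro hinj
  have : (mfderiv 𝓘(ℝ, ℝ × ℝ) 𝓘(ℝ, E3) f p).ker = ⊥ := LinearMap.ker_eq_bot.2 hinj
  rw [IsRankOneSingularPoint, this] at h
  simp at h

theorem vel_comp {φ : ℝ × ℝ → ℝ × ℝ} {z : ℝ × ℝ}
    (hf : MDifferentiableAt 𝓘(ℝ, ℝ × ℝ) 𝓘(ℝ, E3) f (φ z)) (hφ : DifferentiableAt ℝ φ z)
    (w : ℝ × ℝ) : vel (fun z ↦ f (φ z)) w z = vel f (fderiv ℝ φ z w) (φ z) := by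
  refine (mfderiv_comp_apply z hf hφ.mdifferentiableAt w).trans ?_
  rw [mfderiv_eq_fderiv]
  rfl

theorem det_prod (L : ℝ × ℝ →L[ℝ] ℝ × ℝ) :
    L.det = (L (1, 0)).1 * (L (0, 1)).2 - (L (1, 0)).2 * (L (0, 1)).1 := by
  rw [ContinuousLinearMap.det, ← LinearMap.det_toMatrix (Module.Basis.finTwoProd ℝ),
    Matrix.det_fin_two]
  simp [LinearMap.toMatrix_apply]
  ring

/-- Admissible coordinate systems exist: affine ones. -/
theorem exists_isAdmissible (hU : IsOpen U) (hp : p ∈ U)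
    (hf : MDifferentiableAt 𝓘(ℝ, ℝ × ℝ) 𝓘(ℝ, E3) f p) {b : ℝ × ℝ} (hb : b ≠ 0)
    (h : vel f b p = 0) : ∃ φ, IsAdmissible f U p φ := by
  -- The second axis goes to the null vector `b` and the first to `b` turned by a right angle, so
  -- the determinant is `b.1² + b.2² > 0`.
  let L : ℝ × ℝ →L[ℝ] ℝ × ℝ := (ContinuousLinearMap.fst ℝ ℝ ℝ).smulRight (b.2, -b.1) +
    (ContinuousLinearMap.snd ℝ ℝ ℝ).smulRight b
  have hL1 : L (1, 0) = (b.2, -b.1) := by simp [L]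
  have hL2 : L (0, 1) = b := by simp [L]
  have hdet : 0 < L.det := by
    rw [det_prod, hL1, hL2]
    have : b.1 ≠ 0 ∨ b.2 ≠ 0 := by
      by_contra! h
      exact hb (Prod.ext h.1 h.2)
    rcases this with h | h
    · have := sq_pos_of_ne_zero h; nlinarith [sq_nonneg b.2]
    · have := sq_pos_of_ne_zero h; nlinarith [sq_nonneg b.1]
  let e : (ℝ × ℝ) ≃L[ℝ] (ℝ × ℝ) := L.toContinuousLinearEquivOfDetNeZero hdet.ne'
  have he : ∀ z, e z = L z := fun z ↦ rfl
  let A : (ℝ × ℝ) ≃ₜ (ℝ × ℝ) := e.toHomeomorph.trans (Homeomorph.addLeft p)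
  have hA : ∀ z, A z = p + L z := fun z ↦ rfl
  have hA' : ∀ z, A.symm z = e.symm (-p + z) := fun z ↦ rfl
  let φ : OpenPartialHomeomorph (ℝ × ℝ) (ℝ × ℝ) :=
    A.toOpenPartialHomeomorph.restrOpen (A ⁻¹' U) (hU.preimage A.continuous)
  have hφ : ∀ z, φ z = p + L z := fun z ↦ rfl
  have hφ' : (φ : ℝ × ℝ → ℝ × ℝ) = fun z ↦ p + L z := funext hφ
  have hφs : ∀ z, φ.symm z = e.symm (-p + z) := fun z ↦ rfl
  have hsrc : φ.source = A ⁻¹' U := by simp [φ]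
  have hfd : ∀ z, fderiv ℝ φ z = L := fun z ↦ by
    rw [hφ', fderiv_const_add, L.fderiv]
  refine ⟨φ, ⟨?_, ?_, ?_, ?_, ?_, ?_, ?_⟩⟩
  · rw [hsrc, Set.mem_preimage, hA, map_zero, add_zero]
    exact hp
  · rw [hφ, map_zero, add_zero]
  · intro z hz
    have h1 := φ.map_target hz
    rw [hsrc, Set.mem_preimage] at h1
    rwa [show A (φ.symm z) = z from A.apply_symm_apply z] at h1
  · rw [hφ']
    exact (contDiff_const.add L.contDiff).contDiffOn
  · rw [show (φ.symm : ℝ × ℝ → ℝ × ℝ) = fun z ↦ e.symm (-p + z) from funext hφs]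
    exact (e.symm.contDiff.comp (contDiff_const.add contDiff_id)).contDiffOn
  · intro z _
    rw [hfd]
    exact hdet
  · have h0 : φ 0 = p := by rw [hφ, map_zero, add_zero]
    have hd : DifferentiableAt ℝ φ 0 := by rw [hφ']; fun_prop
    -- Quantifying over `q` avoids transport between the tangent spaces at `f (φ 0)` and `f p`,
    -- which agree only propositionally.
    have h1 : ∀ q, q = p → MDifferentiableAt 𝓘(ℝ, ℝ × ℝ) 𝓘(ℝ, E3) f q ∧ vel f b q = 0 := by
      rintro q rfl
      exact ⟨hf, h⟩
    rw [vel_comp (h1 _ h0).1 hd, hfd, hL2]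
    exact (h1 _ h0).2

variable [IsManifold 𝓘(ℝ, E3) ∞ M]

variable [RiemannianBundle (fun x : M ↦ TangentSpace 𝓘(ℝ, E3) x)]

theorem covDeriv_comp {φ : ℝ × ℝ → ℝ × ℝ} {z : ℝ × ℝ}
    (hf : MDifferentiableAt 𝓘(ℝ, ℝ × ℝ) 𝓘(ℝ, E3) f (φ z)) (hφ : DifferentiableAt ℝ φ z)
    (hν : DifferentiableAt ℝ (coordVec (f (φ z)) f ν) (φ z)) (w : ℝ × ℝ) :
    covDeriv (fun z ↦ f (φ z)) (fun z ↦ ν (φ z)) w z = covDeriv f ν (fderiv ℝ φ z w) (φ z) := by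
  have hev : (fun q' ↦ (trivializationAt E3 (TangentSpace 𝓘(ℝ, E3)) (f (φ z)) ⟨f q', ν q'⟩).2)
      =ᶠ[𝓝 (φ z)] coordVec (f (φ z)) f ν := by
    filter_upwards [hf.continuousAt.eventually ((chartAt E3 (f (φ z))).open_source.mem_nhds
      (mem_chart_source E3 (f (φ z))))] with q' hq'
    exact (coords_eq hq' _).symm
  have h1 := fderiv_comp_apply (hev.symm.differentiableAt_iff.1 hν) hφ w
  simp only [covDeriv, h1, vel_comp hf hφ]

theorem IsFrontal.comp (hf : IsFrontal f ν U) (hU : IsOpen U) (hφ : IsAdmissible f U p φ) :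
    IsFrontal (fun z ↦ f (φ z)) (fun z ↦ ν (φ z)) φ.source := by
  have hmaps : Set.MapsTo φ φ.source U := fun z hz ↦ hφ.target_subset (φ.map_source hz)
  refine ⟨hf.smooth.comp hφ.smooth.contMDiffOn hmaps,
    hf.smooth_normal.comp hφ.smooth.contMDiffOn hmaps, fun z hz ↦ hf.unit _ (hmaps hz),
    fun z hz w ↦ ?_⟩
  have hd : DifferentiableAt ℝ φ z :=
    (hφ.smooth.contDiffAt (φ.open_source.mem_nhds hz)).differentiableAt (by simp)
  rw [vel_comp ((hf.contMDiffAt hU (hmaps hz)).mdifferentiableAt (by simp)) hd]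
  exact hf.normal _ (hmaps hz) _

theorem IsAdmissible.vel_eq_zero (hφ : IsAdmissible f U p φ) (hf : IsFrontal f ν U)
    (hU : IsOpen U) : vel f (fderiv ℝ φ 0 (0, 1)) p = 0 := by
  obtain rfl := hφ.map_zero
  have hmem : φ 0 ∈ U := hφ.target_subset (φ.map_source hφ.zero_mem)
  have hd : DifferentiableAt ℝ φ 0 :=
    (hφ.smooth.contDiffAt (φ.open_source.mem_nhds hφ.zero_mem)).differentiableAt (by simp)
  rw [← vel_comp ((hf.contMDiffAt hU hmem).mdifferentiableAt (by simp)) hd]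
  exact hφ.null

variable [IsContMDiffRiemannianBundle 𝓘(ℝ, E3) ∞ E3 (fun x : M ↦ TangentSpace 𝓘(ℝ, E3) x)]

/-- Moving the derivative from `f_x` onto `ν` eliminates the second derivatives of `φ`; only the
vector `dφ(1, 0)` at the origin remains. -/
theorem IsFrontal.normalCurvatureIn_eq (hf : IsFrontal f ν U) (hU : IsOpen U)
    (hφ : IsAdmissible f U p φ) :
    normalCurvatureIn f ν φ = -⟪vel f (fderiv ℝ φ 0 (1, 0)) p, covDeriv f ν (fderiv ℝ φ 0 (1, 0)) p⟫ /
      ‖vel f (fderiv ℝ φ 0 (1, 0)) p‖ ^ 2 := by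
  obtain rfl := hφ.map_zero
  have hmem : φ 0 ∈ U := hφ.target_subset (φ.map_source hφ.zero_mem)
  have hd : DifferentiableAt ℝ φ 0 :=
    (hφ.smooth.contDiffAt (φ.open_source.mem_nhds hφ.zero_mem)).differentiableAt (by simp)
  have hfd := (hf.contMDiffAt hU hmem).mdifferentiableAt (by simp)
  have hν := (contDiffAt_coordVec (mem_chart_source E3 (f (φ 0)))
    (hf.contMDiffAt_normal hU hmem)).differentiableAt (by simp)
  have h := (hf.comp hU hφ).inner_covDeriv_vel φ.open_source hφ.zero_mem (1, 0) (1, 0)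
  rw [covDeriv_comp hfd hd hν, vel_comp hfd hd] at h
  rw [normalCurvatureIn, vel_comp hfd hd]
  congr 1

/-- The limiting normal curvature exists, and it vanishes exactly when the shape operator is
degenerate. -/
theorem IsFront.exists_isLimitingNormalCurvature (hf : IsFront f ν U) (hU : IsOpen U) (hp : p ∈ U)
    (o : ∀ x : M, Orientation ℝ (TangentSpace 𝓘(ℝ, E3) x) (Fin 3))
    (h : IsRankOneSingularPoint f p) : ∃ κ : ℝ, IsLimitingNormalCurvature f ν U p κ ∧
      (κ = 0 ↔ ¬ Function.Injective (covDerivₗ f ν p)) := by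
  have hfd := (hf.contMDiffAt hU hp).mdifferentiableAt (by simp)
  obtain ⟨⟨b, hbk⟩, hb0, hspan⟩ := finrank_eq_one_iff'.1 h
  have hb : vel f b p = 0 := hbk
  have hbne : b ≠ 0 := fun h0 ↦ hb0 (Subtype.ext h0)
  obtain ⟨φ₀, hφ₀⟩ := exists_isAdmissible hU hp hfd hbne hb
  have hbasis : ∀ φ, IsAdmissible f U p φ →
      (fderiv ℝ φ 0 (1, 0)).1 * (fderiv ℝ φ 0 (0, 1)).2 -
        (fderiv ℝ φ 0 (1, 0)).2 * (fderiv ℝ φ 0 (0, 1)).1 ≠ 0 := fun φ hφ ↦ by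
    rw [← det_prod]
    exact (hφ.orientation 0 hφ.zero_mem).ne'
  -- The kernel of `df(p)` is a line already containing the second coordinate vector; if it also
  -- contained the first, the two would be dependent.
  have hne : ∀ φ, IsAdmissible f U p φ → vel f (fderiv ℝ φ 0 (1, 0)) p ≠ 0 := by
    intro φ hφ h0
    obtain ⟨r, hr⟩ := hspan ⟨_, h0⟩
    obtain ⟨s, hs⟩ := hspan ⟨_, hφ.vel_eq_zero hf.toIsFrontal hU⟩
    have hr' : r • b = fderiv ℝ φ 0 (1, 0) := congrArg Subtype.val hr
    have hs' : s • b = fderiv ℝ φ 0 (0, 1) := congrArg Subtype.val hs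
    apply hbasis φ hφ
    rw [← hr', ← hs']
    have key : ∀ c : ℝ × ℝ, (r • c).1 * (s • c).2 - (r • c).2 * (s • c).1 = 0 := fun c ↦ by
      simp only [Prod.smul_fst, Prod.smul_snd, smul_eq_mul]
      ring
    exact key b
  refine ⟨normalCurvatureIn f ν φ₀, ⟨⟨φ₀, hφ₀⟩, fun φ hφ ↦ ?_⟩, ?_⟩
  · rw [hf.normalCurvatureIn_eq hU hφ, hf.normalCurvatureIn_eq hU hφ₀]
    set a := fderiv ℝ φ 0 (1, 0)
    set a₀ := fderiv ℝ φ₀ 0 (1, 0)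
    set b₀ := fderiv ℝ φ₀ 0 (0, 1)
    have hb₀ : vel f b₀ p = 0 := hφ₀.vel_eq_zero hf.toIsFrontal hU
    -- With `a = r a₀ + s b₀` and `b₀` null, the `b₀` part drops out of both numerator and
    -- denominator, and each scales by `r²`.
    obtain ⟨r, s, hrs⟩ := exists_smul_add_smul (hbasis φ₀ hφ₀) a
    have hv : vel f a p = r • vel f a₀ p := by
      rw [hrs]
      have h1 : vel f (r • a₀ + s • b₀) p = vel f (r • a₀) p + vel f (s • b₀) p := map_add _ _ _
      have h2 : vel f (r • a₀) p = r • vel f a₀ p := map_smul _ r a₀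
      have h3 : vel f (s • b₀) p = s • vel f b₀ p := map_smul _ s b₀
      rw [h1, h2, h3, hb₀, smul_zero, add_zero]
    have hr : r ≠ 0 := by
      rintro rfl
      exact hne φ hφ (by rw [hv, zero_smul])
    have hD : ⟪vel f a p, covDeriv f ν a p⟫ = r ^ 2 * ⟪vel f a₀ p, covDeriv f ν a₀ p⟫ := by
      have h0 : ⟪vel f a₀ p, covDeriv f ν b₀ p⟫ = 0 := by
        rw [hf.inner_vel_covDeriv_comm hU hp, hb₀, inner_zero_left]
      rw [hv, hrs, ← covDerivₗ_apply, map_add, map_smul, map_smul, covDerivₗ_apply,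
        covDerivₗ_apply, inner_add_right, real_inner_smul_right, real_inner_smul_right,
        real_inner_smul_left, real_inner_smul_left, h0]
      ring
    have hn : ‖vel f a₀ p‖ ≠ 0 := norm_ne_zero_iff.2 (hne φ₀ hφ₀)
    rw [hD, hv, norm_smul, mul_pow, Real.norm_eq_abs, sq_abs]
    field_simp
  · rw [hf.normalCurvatureIn_eq hU hφ₀, ← hf.inner_vel_covDeriv_eq_zero_iff hU hp o
      (hφ₀.vel_eq_zero hf.toIsFrontal hU) (hbasis φ₀ hφ₀) (hne φ₀ hφ₀)]
    have hn : ‖vel f (fderiv ℝ φ₀ 0 (1, 0)) p‖ ≠ 0 := norm_ne_zero_iff.2 (hne φ₀ hφ₀)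
    rw [div_eq_zero_iff, neg_eq_zero]
    simp [hn]

end NormalCurvature

/-! ### Euclidean space: constant metric, so `∇ν = dν` -/

section Euclidean

theorem chartMetric_euclidean (x y : E3) : chartMetric x y = innerSL ℝ := by
  ext a b
  simp only [chartMetric]
  simp [TangentBundle.symmL_model_space]
  rfl

theorem christoffel_euclidean (x a b : E3) : christoffel x a b = 0 := by
  have h : (chartMetric x : E3 → E3 →L[ℝ] E3 →L[ℝ] ℝ) = fun _ ↦ innerSL ℝ :=
    funext (chartMetric_euclidean x)
  simp only [christoffel, christoffelFst, h]
  simp only [fderiv_fun_const, Pi.zero_apply, zero_apply]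
  refine (congrArg _ ?_).trans (map_zero (InnerProductSpace.toDual ℝ (TangentSpace 𝓘(ℝ, E3) x)).symm)
  ext c
  simp
  rfl

theorem covDeriv_euclidean (f ν : ℝ × ℝ → E3) (w q : ℝ × ℝ) :
    covDeriv f ν w q = fderiv ℝ ν q w := by
  have h : (fun q' ↦ (trivializationAt E3 (TangentSpace 𝓘(ℝ, E3)) (f q)
      ⟨f q', (ν q' : TangentSpace 𝓘(ℝ, E3) (f q'))⟩).2) = ν := by
    funext q'
    simp
  have h0 := christoffel_euclidean (f q) (vel f w q) (ν q)
  simp only [covDeriv, h]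
  exact (congrArg _ h0).trans (add_zero _)

theorem injective_covDerivₗ_euclidean (f ν : ℝ × ℝ → E3) (q : ℝ × ℝ) :
    Function.Injective (covDerivₗ f ν q) ↔ Function.Injective (fderiv ℝ ν q) := by
  have : (covDerivₗ f ν q : ℝ × ℝ → E3) = fderiv ℝ ν q := by
    funext w
    exact (covDerivₗ_apply ..).trans (covDeriv_euclidean f ν w q)
  rw [← this]
  rfl

end Euclidean

end Front

end

theorem theoremA (U : Set (ℝ × ℝ)) (hU : IsOpen U) (p : ℝ × ℝ) (hp : p ∈ U) :
    (∀ (M : Type*) [TopologicalSpace M] [ChartedSpace E3 M] [IsManifold 𝓘(ℝ, E3) ∞ M]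
        [RiemannianBundle (fun x : M ↦ TangentSpace 𝓘(ℝ, E3) x)]
        [IsContMDiffRiemannianBundle 𝓘(ℝ, E3) ∞ E3 (fun x : M ↦ TangentSpace 𝓘(ℝ, E3) x)]
        (o : ∀ x : M, Orientation ℝ (TangentSpace 𝓘(ℝ, E3) x) (Fin 3))
        (_ : Front.IsManifoldOrientation o)
        (f : ℝ × ℝ → M) (ν : ∀ q, TangentSpace 𝓘(ℝ, E3) (f q))
        (_ : Front.IsFront f ν U) (_ : Front.IsRankOneSingularPoint f p),
        ContDiffOn ℝ ∞ (Front.KdA o f ν) U ∧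
        ∃ κ : ℝ, Front.IsLimitingNormalCurvature f ν U p κ ∧
          (κ = 0 ↔ Front.KdA o f ν p = 0)) ∧
    (∀ (o : ∀ x : E3, Orientation ℝ (TangentSpace 𝓘(ℝ, E3) x) (Fin 3))
        (_ : Front.IsManifoldOrientation o)
        (f ν : ℝ × ℝ → E3)
        (_ : Front.IsFront f ν U) (_ : Front.IsRankOneSingularPoint f p),
        ∃ κ : ℝ, Front.IsLimitingNormalCurvature f ν U p κ ∧
          (κ = 0 ↔ Front.KdA o f ν p = 0) ∧
          (κ = 0 ↔ ¬ Function.Injective (fderiv ℝ ν p))) := by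
  constructor
  · intro M _ _ _ _ _ o ho f ν hf h
    obtain ⟨κ, hκ, hκ0⟩ := hf.exists_isLimitingNormalCurvature hU hp o h
    exact ⟨hf.contDiffOn_KdA ho hU, κ, hκ,
      hκ0.trans (hf.KdA_eq_zero_iff hU hp h.isSingularPoint).symm⟩
  · intro o ho f ν hf h
    obtain ⟨κ, hκ, hκ0⟩ := hf.exists_isLimitingNormalCurvature hU hp o h
    exact ⟨κ, hκ, hκ0.trans (hf.KdA_eq_zero_iff hU hp h.isSingularPoint).symm,
      hκ0.trans (not_congr (Front.injective_covDerivₗ_euclidean f ν p))⟩
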